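/- Let $\Omega\subset\mathbb{R}^2$ be closed, let $f,u:\Omega\to\mathbb{R}$ be smooth, and let $\nu(s)=\sqrt{1+s^2}$ (the $L^2$ amoeba metric). For $p,q\in\Omega$ let the amoeba distance $d(p,q)$ be the infimum, over all regular $C^1$ curves $\gamma:[0,1]\to\Omega$ from $p$ to $q$, of $$L_\nu(\gamma)=\int_0^1\nu\!\left(\frac{(f\circ\gamma)'(t)}{|\gamma'(t)|}\right)|\gamma'(t)|\,\mathrm{d}t$$ ($+\infty$ if there is no such curve), and let $\mathcal{A}_{\varrho}(p)=\{q\in\Omega: d(p,q)\le\varrho\}$ be the amoeba of radius $\varrho$ around $p$. A median of $u$ on a set $A$ is a number $\mu$ such that each of $\{x\in A: u(x)\ge\mu\}$ and $\{x\in A: u(x)\le\mu\}$ has at least half of the area of $A$. For $s,\alpha\in\mathbb{R}$ put $$J_1(s,\alpha)=\int_{\alpha-\pi/2}^{\alpha+\pi/2}\frac{\nu'(s\cos\vartheta)}{\nu(s\cos\vartheta)^4}\sin^2\vartheta\,\mathrm{d}\vartheta,\quad J_2(s,\alpha)=\int_{\alpha-\pi/2}^{\alpha+\pi/2}\frac{\nu'(s\cos\vartheta)}{\nu(s\cos\vartheta)^4}\sin\vartheta\cos\vartheta\,\mathrm{d}\vartheta,\quad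 J_3(s,\alpha)=\int_{\alpha-\pi/2}^{\alpha+\pi/2}\frac{\nu'(s\cos\vartheta)}{\nu(s\cos\vartheta)^4}\cos^2\vartheta\,\mathrm{d}\vartheta .$$ At a point $x$ let $\varphi$ be a direction angle of $\nabla f$ and $\varphi+\alpha$ a direction angle of $\nabla u$ (so $\nabla f=|\nabla f|\,(\cos\varphi,\sin\varphi)^{\mathrm T}$ and $\nabla u=|\nabla u|\,(\cos(\varphi+\alpha),\sin(\varphi+\alpha))^{\mathrm T}$; if $\nabla f=0$, any $\varphi$ is allowed), and let $\chi=(\cos\varphi,\sin\varphi)^{\mathrm T}$, $\zeta=(-\sin\varphi,\cos\varphi)^{\mathrm T}$, $\xi=(-\sin(\varphi+\alpha),\cos(\varphi+\alpha))^{\mathrm T}$. Subscripts denote second directional derivatives, e.g. $f_{\zeta\chi}=\zeta^{\mathrm T}\mathrm{D}^2f\,\chi$. Then the following hold. (i) For all real $s,\alpha$, $$J_1=\frac23\,\frac{s\cos^3\alpha}{(1+s^2)(1+s^2\sin^2\alpha)^{3/2}},\quad J_2=\frac23\,\frac{s\sin^3\alpha}{(1+s^2\sin^2\alpha)^{3/2}},\quad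 J_3=\frac23\,\frac{s\cos\alpha\,(2+\sin^2\alpha+3s^2\sin^2\alpha)}{(1+s^2)^2(1+s^2\sin^2\alpha)^{3/2}} .$$ (ii) Consequently, for $\nu(s)=\sqrt{1+s^2}$, the equation $$u_t=\frac{u_{\xi\xi}}{\nu(|\nabla f|\sin\alpha)^2}-\frac32\,\nu(|\nabla f|\sin\alpha)\,|\nabla u|\,\bigl(J_1(|\nabla f|,\alpha)f_{\zeta\zeta}+2J_2(|\nabla f|,\alpha)f_{\zeta\chi}+J_3(|\nabla f|,\alpha)f_{\chi\chi}\bigr)$$ is the explicit equation $u_t=R[f,u]$ with $$R[f,u]=\frac{u_{\xi\xi}}{1+|\nabla f|^2\sin^2\alpha}-\frac{|\nabla f|\,|\nabla u|}{1+|\nabla f|^2\sin^2\alpha}\left(\frac{f_{\zeta\zeta}\cos^3\alpha}{1+|\nabla f|^2}+2f_{\zeta\chi}\sin^3\alpha+\frac{f_{\chi\chi}\cos\alpha\,\bigl(2+\sin^2\alpha+3|\nabla f|^2\sin^2\alpha\bigr)}{(1+|\nabla f|^2)^2}\right).$$ (iii) One step of amoeba median filtering of $u$ with amoebas generated from $f$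 approximates, as $\varrho\to0$, an explicit time step of size $\varrho^2/6$ for this equation: for every interior point $x_0$ of $\Omega$ with $\nabla u(x_0)\neq0$, for all sufficiently small $\varrho>0$ the function $u$ has exactly one median $\mu(\varrho)$ on $\mathcal{A}_{\varrho}(x_0)$, and $$\mu(\varrho)=u(x_0)+\frac{\varrho^2}{6}\,R[f,u](x_0)+\mathcal{O}(\varrho^3)\qquad(\varrho\to0).$$ -/

import Mathlib

open scoped ContDiff

namespace Amoeba

/-- The plane with its Euclidean norm. -/
abbrev Plane : Type := EuclideanSpace ℝ (Fin 2)

/-- The function `ν` of the L² amoeba metric. -/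
noncomputable def nuL2 (s : ℝ) : ℝ := Real.sqrt (1 + s ^ 2)

/-- `γ`, restricted to `[0, 1]`, is a regular `C¹` curve inside `Ω` from `p` to `q`.  It is the
planar projection of a curve on the graph of the image; as the image is smooth, the curve on the
graph is regular exactly if its projection is. -/
structure IsRegularCurve (Ω : Set Plane) (p q : Plane) (γ : ℝ → Plane) : Prop where
  contDiffOn : ContDiffOn ℝ 1 γ (Set.Icc 0 1)
  regular : ∀ t ∈ Set.Icc (0 : ℝ) 1, derivWithin γ (Set.Icc 0 1) t ≠ 0
  mem : ∀ t ∈ Set.Icc (0 : ℝ) 1, γ t ∈ Ω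
  source : γ 0 = p
  target : γ 1 = q

/-- The length `L_ν` of the curve `t ↦ (γ t, f (γ t))` on the graph of `f`. -/
noncomputable def curveLength (ν : ℝ → ℝ) (f : Plane → ℝ) (γ : ℝ → Plane) : ℝ :=
  ∫ t in (0 : ℝ)..1, ν (deriv (fun τ => f (γ τ)) t / ‖deriv γ t‖) * ‖deriv γ t‖

/-- The amoeba distance on `Ω` generated by `f`: the infimum of the lengths of the connecting
curves.  It is `∞` for points that no curve in `Ω` connects. -/
noncomputable def amoebaDist (ν : ℝ → ℝ) (Ω : Set Plane) (f : Plane → ℝ) (p q : Plane) :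
    ENNReal :=
  ⨅ (γ : ℝ → Plane) (_ : IsRegularCurve Ω p q γ), ENNReal.ofReal (curveLength ν f γ)

/-- The amoeba of radius `ρ` around `p`. -/
def amoeba (ν : ℝ → ℝ) (Ω : Set Plane) (f : Plane → ℝ) (ρ : ℝ) (p : Plane) : Set Plane :=
  {q | q ∈ Ω ∧ amoebaDist ν Ω f p q ≤ ENNReal.ofReal ρ}

/-- `μ` is a median of the values of `u` on `A` with respect to area: each of the two parts of `A`
where `u ≥ μ` and where `u ≤ μ` has at least half of the area of `A`. -/
def IsMedian (u : Plane → ℝ) (A : Set Plane) (μ : ℝ) : Prop :=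
  MeasureTheory.volume A / 2 ≤ MeasureTheory.volume {x | x ∈ A ∧ μ ≤ u x} ∧
  MeasureTheory.volume A / 2 ≤ MeasureTheory.volume {x | x ∈ A ∧ u x ≤ μ}

/-- The unit vector with direction angle `θ`. -/
noncomputable def unitVec (θ : ℝ) : Plane := !₂[Real.cos θ, Real.sin θ]

/-- The unit vector with direction angle `θ`, rotated counterclockwise by a right angle. -/
noncomputable def unitNormal (θ : ℝ) : Plane := !₂[-Real.sin θ, Real.cos θ]

/-- The second directional derivative `g_{vw} = vᵀ D²g w` at `x`. -/
noncomputable def secondDeriv (g : Plane → ℝ) (x v w : Plane) : ℝ :=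
  fderiv ℝ (fderiv ℝ g) x v w

/-- The coefficient integral `J₁`. -/
noncomputable def J1 (ν : ℝ → ℝ) (s α : ℝ) : ℝ :=
  ∫ θ in (α - Real.pi / 2)..(α + Real.pi / 2),
    deriv ν (s * Real.cos θ) / ν (s * Real.cos θ) ^ 4 * Real.sin θ ^ 2

/-- The coefficient integral `J₂`. -/
noncomputable def J2 (ν : ℝ → ℝ) (s α : ℝ) : ℝ :=
  ∫ θ in (α - Real.pi / 2)..(α + Real.pi / 2),
    deriv ν (s * Real.cos θ) / ν (s * Real.cos θ) ^ 4 * (Real.sin θ * Real.cos θ)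

/-- The coefficient integral `J₃`. -/
noncomputable def J3 (ν : ℝ → ℝ) (s α : ℝ) : ℝ :=
  ∫ θ in (α - Real.pi / 2)..(α + Real.pi / 2),
    deriv ν (s * Real.cos θ) / ν (s * Real.cos θ) ^ 4 * Real.cos θ ^ 2

/-- Right-hand side at `x` of the evolution equation for a general amoeba metric, expressed with
`J₁`, `J₂`, `J₃`.  Here `φ` is the direction angle of the gradient of `f` at `x` and `φ + α` that
of the gradient of `u`; thus `χ = unitVec φ`, `ζ = unitNormal φ`, `η = unitVec (φ + α)` and
`ξ = unitNormal (φ + α)`. -/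
noncomputable def generalRhs (ν : ℝ → ℝ) (f u : Plane → ℝ) (φ α : ℝ) (x : Plane) : ℝ :=
  let χ := unitVec φ
  let ζ := unitNormal φ
  let ξ := unitNormal (φ + α)
  let s := ‖gradient f x‖
  secondDeriv u x ξ ξ / ν (s * Real.sin α) ^ 2
    - 3 / 2 * ν (s * Real.sin α) * ‖gradient u x‖ *
      (J1 ν s α * secondDeriv f x ζ ζ + 2 * J2 ν s α * secondDeriv f x ζ χ
        + J3 ν s α * secondDeriv f x χ χ)

/-- Right-hand side at `x` of the explicit evolution equation for the L² amoeba metric, with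
`φ`, `α` and the vectors `χ`, `ζ`, `ξ` as for a general metric. -/
noncomputable def l2Rhs (f u : Plane → ℝ) (φ α : ℝ) (x : Plane) : ℝ :=
  let χ := unitVec φ
  let ζ := unitNormal φ
  let ξ := unitNormal (φ + α)
  let s := ‖gradient f x‖
  secondDeriv u x ξ ξ / (1 + s ^ 2 * Real.sin α ^ 2)
    - s * ‖gradient u x‖ / (1 + s ^ 2 * Real.sin α ^ 2) *
      (secondDeriv f x ζ ζ * Real.cos α ^ 3 / (1 + s ^ 2)
        + 2 * secondDeriv f x ζ χ * Real.sin α ^ 3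
        + secondDeriv f x χ χ * Real.cos α *
            (2 + Real.sin α ^ 2 + 3 * s ^ 2 * Real.sin α ^ 2) / (1 + s ^ 2) ^ 2)

end Amoeba

open MeasureTheory

namespace Amoeba

/-! The integrals have elementary antiderivatives, and inserting their values into the general
equation is algebra. The asymptotic statement does not go through them: it is proved by comparing
areas directly.

For `ν(s) = √(1 + s²)` the curve length is the Euclidean length on the graph of `f`. A chord is no
longer than a curve, and a straight planar segment exceeds its chord only at fourth order. Hence the
amoeba lies between two sublevel sets of `‖h‖² + (f(x₀+h) - f(x₀))²` whose levels differ by `O(ρ⁴)`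
(`amoeba_nuL2_subset`, `exists_mem_amoeba_of_chord_le`). In a basis orthonormal for the graph
metric, with second vector tangent to the level line of `u`, and after rescaling by `ρ = ε`, the
amoeba becomes `Q ≤ 1` up to `O(ε²)` with `Q = x² + y² + ε·cubic + O(ε²)`, and the increment of `u`
becomes `U = A x + ε·quad + O(ε²)` (`exists_chart`, `exists_scaled_bounds`).

The median is located without computing any area. A map `z ↦ -z + ε V(z)` is built whose field is,
to leading order, divergence-free, preserves the perturbed circle, and reflects the values of `U`
near the level line about `ε·shift`. An additional affine field of relative size `Kε` gains area and
pushes the image inwards, both at order `ε²`. So the part of the amoeba with `U ≥ ε·shift + C₁ε²` is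
mapped injectively, with increase of area, into the part where `U` is smaller
(`exists_area_increasing_reflection`). Therefore every median lies below that level; the identity
`shift = R/6` gives the upper bound, and the same argument for `-u` gives the lower one.

Existence of a median holds for any set of finite area. Uniqueness holds because the amoeba contains
a punctured disc of radius comparable to `ρ`, on which `u` takes all values near `u(x₀)`, so no gap
between two medians can be null. -/

/-! ### The coefficient integrals and the explicit equation -/

theorem nuL2_pos (x : ℝ) : 0 < nuL2 x := Real.sqrt_pos.2 (by positivity)

theorem hasDerivAt_nuL2 (x : ℝ) : HasDerivAt nuL2 (x / nuL2 x) x := by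
  have h : HasDerivAt (fun s : ℝ => 1 + s ^ 2) (2 * x) x := by
    simpa using (hasDerivAt_pow 2 x).const_add 1
  have h2 := h.sqrt (by positivity)
  refine h2.congr_deriv ?_
  rw [mul_div_mul_left _ _ two_ne_zero]
  rfl

theorem deriv_nuL2 (x : ℝ) : deriv nuL2 x = x / nuL2 x := (hasDerivAt_nuL2 x).deriv

theorem nuL2_sq (x : ℝ) : nuL2 x ^ 2 = 1 + x ^ 2 := Real.sq_sqrt (by positivity)

theorem continuous_nuL2 : Continuous nuL2 := by unfold nuL2; fun_prop

theorem hasDerivAt_nuL2_cos (s θ : ℝ) :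
    HasDerivAt (fun θ => nuL2 (s * Real.cos θ))
      (s * Real.cos θ / nuL2 (s * Real.cos θ) * (s * -Real.sin θ)) θ :=
  HasDerivAt.comp (h₂ := nuL2) θ (hasDerivAt_nuL2 (s * Real.cos θ))
    ((Real.hasDerivAt_cos θ).const_mul s)

theorem sqrt_pow_three_eq_rpow {x : ℝ} (hx : 0 < x) : Real.sqrt x ^ 3 = x ^ (3 / 2 : ℝ) := by
  rw [Real.sqrt_eq_rpow, ← Real.rpow_natCast, ← Real.rpow_mul hx.le]
  norm_num

/-- With `σ = sin θ` the integrand is `s σ² dσ / (1 + s² - s²σ²)^(5/2)`, which integrates to `s σ³ /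
(3 (1 + s²) ν³)`. At both end points `ν` has the same value, because `cos (α ± π/2) = ∓ sin α` and
`ν` is even. -/
theorem J1_nuL2 (s α : ℝ) : J1 nuL2 s α = 2 / 3 * s * (Real.cos α ^ 3 /
    ((1 + s ^ 2) * (1 + s ^ 2 * Real.sin α ^ 2) ^ (3 / 2 : ℝ))) := by
  unfold J1
  rw [intervalIntegral.integral_eq_sub_of_hasDerivAt
    (f := fun θ => s * Real.sin θ ^ 3 / (3 * (1 + s ^ 2) * nuL2 (s * Real.cos θ) ^ 3))]
  · rw [Real.cos_add_pi_div_two, Real.cos_sub_pi_div_two, Real.sin_add_pi_div_two,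
      Real.sin_sub_pi_div_two, ← sqrt_pow_three_eq_rpow (by positivity)]
    have e1 : nuL2 (s * -Real.sin α) = √(1 + s ^ 2 * Real.sin α ^ 2) := by unfold nuL2; ring_nf
    have e2 : nuL2 (s * Real.sin α) = √(1 + s ^ 2 * Real.sin α ^ 2) := by unfold nuL2; ring_nf
    rw [e1, e2]
    have : 0 < √(1 + s ^ 2 * Real.sin α ^ 2) := Real.sqrt_pos.2 (by positivity)
    field_simp
    ring
  · intro θ _
    have hp := nuL2_pos (s * Real.cos θ)
    have hd := (((Real.hasDerivAt_sin θ).pow 3).const_mul s).div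
      (((hasDerivAt_nuL2_cos s θ).pow 3).const_mul (3 * (1 + s ^ 2)))
      (show 3 * (1 + s ^ 2) * nuL2 (s * Real.cos θ) ^ 3 ≠ 0 by positivity)
    refine hd.congr_deriv ?_
    rw [deriv_nuL2]
    have h2 := nuL2_sq (s * Real.cos θ)
    have hs := Real.sin_sq_add_cos_sq θ
    simp only [Pi.pow_apply]
    set n := nuL2 (s * Real.cos θ)
    set S := Real.sin θ
    set D := Real.cos θ
    field_simp
    push_cast
    have h3 : n ^ 2 + s ^ 2 * S ^ 2 = 1 + s ^ 2 := by rw [h2]; linear_combination s ^ 2 * hs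
    linear_combination (3 * n ^ 2 * D * S ^ 2 * s) * h3
  · apply Continuous.intervalIntegrable
    simp_rw [deriv_nuL2]
    have := continuous_nuL2
    have h : ∀ x, nuL2 x ≠ 0 := fun x => (nuL2_pos x).ne'
    fun_prop (disch := intros; simp [h])

theorem J2_nuL2 (s α : ℝ) : J2 nuL2 s α =
    2 / 3 * s * (Real.sin α ^ 3 / (1 + s ^ 2 * Real.sin α ^ 2) ^ (3 / 2 : ℝ)) := by
  unfold J2
  rw [intervalIntegral.integral_eq_sub_of_hasDerivAt
    (f := fun θ => - (s * Real.cos θ ^ 3) / (3 * nuL2 (s * Real.cos θ) ^ 3))]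
  · rw [Real.cos_add_pi_div_two, Real.cos_sub_pi_div_two, ← sqrt_pow_three_eq_rpow (by positivity)]
    have e1 : nuL2 (s * -Real.sin α) = √(1 + s ^ 2 * Real.sin α ^ 2) := by unfold nuL2; ring_nf
    have e2 : nuL2 (s * Real.sin α) = √(1 + s ^ 2 * Real.sin α ^ 2) := by unfold nuL2; ring_nf
    rw [e1, e2]
    have : 0 < √(1 + s ^ 2 * Real.sin α ^ 2) := Real.sqrt_pos.2 (by positivity)
    field_simp
    ring
  · intro θ _
    have hp := nuL2_pos (s * Real.cos θ)
    have hd := (((Real.hasDerivAt_cos θ).pow 3).const_mul s).neg.div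
      (((hasDerivAt_nuL2_cos s θ).pow 3).const_mul 3)
      (show 3 * nuL2 (s * Real.cos θ) ^ 3 ≠ 0 by positivity)
    refine hd.congr_deriv ?_
    rw [deriv_nuL2]
    have h2 := nuL2_sq (s * Real.cos θ)
    have hs := Real.sin_sq_add_cos_sq θ
    simp only [Pi.pow_apply, Pi.neg_apply]
    set n := nuL2 (s * Real.cos θ)
    set S := Real.sin θ
    set D := Real.cos θ
    field_simp
    push_cast
    linear_combination (3 * n ^ 2 * D ^ 2 * S * s) * h2
  · apply Continuous.intervalIntegrable
    simp_rw [deriv_nuL2]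
    have := continuous_nuL2
    have h : ∀ x, nuL2 x ≠ 0 := fun x => (nuL2_pos x).ne'
    fun_prop (disch := intros; simp [h])

/-- The substitution `σ = sin θ` again gives a rational function of `σ` and `ν`; its numerator,
rewritten with `σ² = 1 - cos² θ`, is the factor `2 + cos² θ + 3 s² cos² θ`. -/
theorem J3_nuL2 (s α : ℝ) : J3 nuL2 s α =
    2 / 3 * s * (Real.cos α * (2 + Real.sin α ^ 2 + 3 * s ^ 2 * Real.sin α ^ 2) /
      ((1 + s ^ 2) ^ 2 * (1 + s ^ 2 * Real.sin α ^ 2) ^ (3 / 2 : ℝ))) := by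
  unfold J3
  rw [intervalIntegral.integral_eq_sub_of_hasDerivAt
    (f := fun θ => s * (Real.sin θ * (2 + Real.cos θ ^ 2 + 3 * s ^ 2 * Real.cos θ ^ 2)) /
      (3 * (1 + s ^ 2) ^ 2 * nuL2 (s * Real.cos θ) ^ 3))]
  · rw [Real.cos_add_pi_div_two, Real.cos_sub_pi_div_two, Real.sin_add_pi_div_two,
      Real.sin_sub_pi_div_two, ← sqrt_pow_three_eq_rpow (by positivity)]
    have e1 : nuL2 (s * -Real.sin α) = √(1 + s ^ 2 * Real.sin α ^ 2) := by unfold nuL2; ring_nf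
    have e2 : nuL2 (s * Real.sin α) = √(1 + s ^ 2 * Real.sin α ^ 2) := by unfold nuL2; ring_nf
    rw [e1, e2]
    have : 0 < √(1 + s ^ 2 * Real.sin α ^ 2) := Real.sqrt_pos.2 (by positivity)
    field_simp
    ring
  · intro θ _
    have hp := nuL2_pos (s * Real.cos θ)
    have hd := (((Real.hasDerivAt_sin θ).mul ((((Real.hasDerivAt_cos θ).pow 2).const_add 2).add
      (((Real.hasDerivAt_cos θ).pow 2).const_mul (3 * s ^ 2)))).const_mul s).div
      (((hasDerivAt_nuL2_cos s θ).pow 3).const_mul (3 * (1 + s ^ 2) ^ 2))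
      (show 3 * (1 + s ^ 2) ^ 2 * nuL2 (s * Real.cos θ) ^ 3 ≠ 0 by positivity)
    refine hd.congr_deriv ?_
    rw [deriv_nuL2]
    have h2 := nuL2_sq (s * Real.cos θ)
    have hs := Real.sin_sq_add_cos_sq θ
    simp only [Pi.pow_apply, Pi.mul_apply, Pi.add_apply]
    set n := nuL2 (s * Real.cos θ)
    set S := Real.sin θ
    set D := Real.cos θ
    have hS : S ^ 2 = 1 - D ^ 2 := by linear_combination hs
    field_simp
    push_cast
    ring_nf
    have h4 : n ^ 4 = (1 + (s * D) ^ 2) ^ 2 := by rw [← h2]; ring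
    simp only [h2, h4, hS]
    ring
  · apply Continuous.intervalIntegrable
    simp_rw [deriv_nuL2]
    have := continuous_nuL2
    have h : ∀ x, nuL2 x ≠ 0 := fun x => (nuL2_pos x).ne'
    fun_prop (disch := intros; simp [h])

/-- The prefactor `3/2` cancels the common `2/3`, and `ν(s sin α)` cancels one of the three powers
of `w = √(1 + s² sin² α)` in the denominators. -/
theorem generalRhs_nuL2 (f u : Plane → ℝ) (φ α : ℝ) (x : Plane) :
    generalRhs nuL2 f u φ α x = l2Rhs f u φ α x := by
  unfold generalRhs l2Rhs
  simp only [J1_nuL2, J2_nuL2, J3_nuL2, nuL2_sq]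
  generalize ‖gradient f x‖ = s
  rw [← sqrt_pow_three_eq_rpow (x := 1 + s ^ 2 * Real.sin α ^ 2) (by positivity)]
  have e : nuL2 (s * Real.sin α) = √(1 + s ^ 2 * Real.sin α ^ 2) := by unfold nuL2; ring_nf
  have hp : 0 < √(1 + s ^ 2 * Real.sin α ^ 2) := Real.sqrt_pos.2 (by positivity)
  have hq : √(1 + s ^ 2 * Real.sin α ^ 2) ^ 2 = 1 + s ^ 2 * Real.sin α ^ 2 :=
    Real.sq_sqrt (by positivity)
  rw [e, mul_pow s]
  set w := √(1 + s ^ 2 * Real.sin α ^ 2)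
  clear_value w
  rw [← hq]
  field_simp

/-! ### Amoebas and chord lengths on the graph -/

/-- This turns the integrand of `curveLength` into the Euclidean speed of the lifted curve on the
graph. -/
theorem nuL2_div_mul {v : ℝ} (hv : 0 < v) (d : ℝ) : nuL2 (d / v) * v = √(v ^ 2 + d ^ 2) := by
  nth_rw 2 [← Real.sqrt_sq hv.le]
  rw [nuL2, ← Real.sqrt_mul (by positivity)]
  congr 1
  field_simp

/-- A `C¹` curve on `[0, 1]` is differentiable inside with the within-derivative, which is
continuous up to the end points. -/
theorem hasDerivAt_of_contDiffOn_Icc {E : Type*} [NormedAddCommGroup E] [NormedSpace ℝ E]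
    {γ : ℝ → E} (h : ContDiffOn ℝ 1 γ (Set.Icc 0 1)) {t : ℝ} (ht : t ∈ Set.Ioo (0 : ℝ) 1) :
    HasDerivAt γ (derivWithin γ (Set.Icc 0 1) t) t :=
  ((h.differentiableOn one_ne_zero t
    (Set.Ioo_subset_Icc_self ht)).hasDerivWithinAt).hasDerivAt (Icc_mem_nhds ht.1 ht.2)

theorem curveLength_nuL2_eq {Ω : Set Plane} {f : Plane → ℝ} {p q : Plane} {γ : ℝ → Plane}
    (hf : ContDiffOn ℝ 1 f Ω) (h : IsRegularCurve Ω p q γ) :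
    curveLength nuL2 f γ = ∫ t in (0 : ℝ)..1,
      √(‖derivWithin γ (Set.Icc 0 1) t‖ ^ 2
        + derivWithin (fun τ => f (γ τ)) (Set.Icc 0 1) t ^ 2) := by
  unfold curveLength
  have hc : ContDiffOn ℝ 1 (fun τ => f (γ τ)) (Set.Icc 0 1) := hf.comp h.contDiffOn h.mem
  refine intervalIntegral.integral_congr_Ioo_of_le zero_le_one fun t ht => ?_
  simp only [(hasDerivAt_of_contDiffOn_Icc h.contDiffOn ht).deriv,
    (hasDerivAt_of_contDiffOn_Icc hc ht).deriv]
  exact nuL2_div_mul (norm_pos_iff.2 (h.regular t (Set.Ioo_subset_Icc_self ht))) _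

/-- Integrate the scalar product of the velocity of the lifted curve with the chord vector: the
result is the squared chord length, and by Cauchy–Schwarz it is at most the chord length times the
curve length. -/
theorem chord_le_curveLength {Ω : Set Plane} {f : Plane → ℝ} {p q : Plane} {γ : ℝ → Plane}
    (hf : ContDiffOn ℝ 1 f Ω) (h : IsRegularCurve Ω p q γ) :
    √(‖q - p‖ ^ 2 + (f q - f p) ^ 2) ≤ curveLength nuL2 f γ := by
  rw [curveLength_nuL2_eq hf h]
  have hc : ContDiffOn ℝ 1 (fun τ => f (γ τ)) (Set.Icc 0 1) := hf.comp h.contDiffOn h.mem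
  have hcγ := h.contDiffOn.continuousOn_derivWithin (uniqueDiffOn_Icc zero_lt_one) le_rfl
  have hcf := hc.continuousOn_derivWithin (uniqueDiffOn_Icc zero_lt_one) le_rfl
  set v := derivWithin γ (Set.Icc 0 1)
  set d := derivWithin (fun τ => f (γ τ)) (Set.Icc 0 1)
  set L := √(‖q - p‖ ^ 2 + (f q - f p) ^ 2) with hL
  have hLsq : L ^ 2 = ‖q - p‖ ^ 2 + (f q - f p) ^ 2 := Real.sq_sqrt (by positivity)
  have hL0 : 0 ≤ L := Real.sqrt_nonneg _
  have iγ : IntervalIntegrable v volume 0 1 :=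
    ContinuousOn.intervalIntegrable (by rwa [Set.uIcc_of_le zero_le_one])
  have iF : IntervalIntegrable d volume 0 1 :=
    ContinuousOn.intervalIntegrable (by rwa [Set.uIcc_of_le zero_le_one])
  have eγ : ∫ t in (0 : ℝ)..1, v t = q - p := by
    rw [intervalIntegral.integral_eq_sub_of_hasDerivAt_of_le zero_le_one h.contDiffOn.continuousOn
      (fun t ht => hasDerivAt_of_contDiffOn_Icc h.contDiffOn ht) iγ, h.source, h.target]
  have eF : ∫ t in (0 : ℝ)..1, d t = f q - f p := by
    rw [intervalIntegral.integral_eq_sub_of_hasDerivAt_of_le zero_le_one hc.continuousOn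
      (fun t ht => hasDerivAt_of_contDiffOn_Icc hc ht) iF]
    simp only [h.source, h.target]
  have i1 : IntervalIntegrable (fun t => inner ℝ (q - p) (v t)) volume 0 1 :=
    ContinuousOn.intervalIntegrable (by
      rw [Set.uIcc_of_le zero_le_one]; exact continuousOn_const.inner hcγ)
  have e1 : ∫ t in (0 : ℝ)..1, inner ℝ (q - p) (v t) = ‖q - p‖ ^ 2 := by
    have := (innerSL ℝ (q - p)).intervalIntegral_comp_comm iγ
    simp only [innerSL_apply_apply] at this
    rw [this, eγ, real_inner_self_eq_norm_sq]
  have key : L * L ≤ L * ∫ t in (0 : ℝ)..1, √(‖v t‖ ^ 2 + d t ^ 2) := by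
    calc L * L = ∫ t in (0 : ℝ)..1, (inner ℝ (q - p) (v t) + (f q - f p) * d t) := by
          rw [intervalIntegral.integral_add i1 (iF.const_mul _), e1,
            intervalIntegral.integral_const_mul, eF, ← sq, hLsq]
          ring
      _ ≤ ∫ t in (0 : ℝ)..1, L * √(‖v t‖ ^ 2 + d t ^ 2) := by
          refine intervalIntegral.integral_mono_on zero_le_one (i1.add (iF.const_mul _)) ?_ ?_
          · refine ContinuousOn.intervalIntegrable ?_
            rw [Set.uIcc_of_le zero_le_one]
            exact continuousOn_const.mul ((hcγ.norm.pow 2).add (hcf.pow 2)).sqrt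
          · intro t _
            rw [hL, ← Real.sqrt_mul (by positivity)]
            refine Real.le_sqrt_of_sq_le ?_
            have a1 := abs_real_inner_le_norm (q - p) (v t)
            have a2 : (inner ℝ (q - p) (v t) + (f q - f p) * d t) ^ 2
                ≤ (‖q - p‖ * ‖v t‖ + |f q - f p| * |d t|) ^ 2 := by
              refine sq_le_sq' ?_ ?_
              · have := abs_mul (f q - f p) (d t)
                have := neg_abs_le ((f q - f p) * d t)
                have := neg_abs_le (inner ℝ (q - p) (v t))
                linarith
              · have := abs_mul (f q - f p) (d t)
                have := le_abs_self ((f q - f p) * d t)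
                have := le_abs_self (inner ℝ (q - p) (v t))
                linarith
            refine a2.trans ?_
            rw [← sq_abs (f q - f p), ← sq_abs (d t)]
            nlinarith [sq_nonneg (‖q - p‖ * |d t| - |f q - f p| * ‖v t‖)]
      _ = _ := intervalIntegral.integral_const_mul _ _
  rcases hL0.eq_or_lt with h0 | h0
  · rw [← h0]
    exact intervalIntegral.integral_nonneg zero_le_one fun t _ => Real.sqrt_nonneg _
  · exact le_of_mul_le_mul_left key h0

theorem amoeba_nuL2_subset {Ω : Set Plane} {f : Plane → ℝ} {p : Plane} {ρ : ℝ} (hρ : 0 ≤ ρ)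
    (hf : ContDiffOn ℝ 1 f Ω) :
    amoeba nuL2 Ω f ρ p ⊆ {q | ‖q - p‖ ^ 2 + (f q - f p) ^ 2 ≤ ρ ^ 2} := by
  rintro q ⟨-, hq⟩
  have h1 : ENNReal.ofReal √(‖q - p‖ ^ 2 + (f q - f p) ^ 2) ≤ ENNReal.ofReal ρ := by
    refine le_trans ?_ hq
    exact le_iInf₂ fun γ hγ => ENNReal.ofReal_le_ofReal (chord_le_curveLength hf hγ)
  rw [ENNReal.ofReal_le_ofReal_iff hρ, Real.sqrt_le_left hρ] at h1
  exact h1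

/-- The straight segment shows that a point with slightly smaller chord length belongs to the
amoeba. -/
theorem add_mem_amoeba_nuL2 {Ω U : Set Plane} {f : Plane → ℝ} {p h : Plane} {K ρ : ℝ}
    (hU : IsOpen U) (hUΩ : U ⊆ Ω) (hf : ContDiffOn ℝ 1 f U) (hh : h ≠ 0) (hρ : 0 < ρ)
    (hseg : ∀ t ∈ Set.Icc (0 : ℝ) 1, p + t • h ∈ U)
    (hK : ∀ t ∈ Set.Icc (0 : ℝ) 1, |fderiv ℝ f (p + t • h) h - (f (p + h) - f p)| ≤ K * ‖h‖ ^ 2)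
    (hle : ‖h‖ ^ 2 + (f (p + h) - f p) ^ 2 + K ^ 2 * ‖h‖ ^ 4 ≤ ρ ^ 2) :
    p + h ∈ amoeba nuL2 Ω f ρ p := by
  have hd : ∀ t, HasDerivAt (fun t : ℝ => p + t • h) h t := fun t => by
    simpa using ((hasDerivAt_id t).smul_const h).const_add p
  have hfd : ∀ t ∈ Set.Icc (0 : ℝ) 1,
      HasDerivAt (fun t : ℝ => f (p + t • h)) (fderiv ℝ f (p + t • h) h) t := fun t ht =>
    (((hf.differentiableOn one_ne_zero).differentiableAt
      (hU.mem_nhds (hseg t ht))).hasFDerivAt).comp_hasDerivAt t (hd t)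
  have hcont : ContinuousOn (fun t : ℝ => fderiv ℝ f (p + t • h) h) (Set.Icc 0 1) :=
    ((hf.continuousOn_fderiv_of_isOpen hU le_rfl).comp
      (by fun_prop) hseg).clm_apply continuousOn_const
  have hreg : IsRegularCurve Ω p (p + h) (fun t : ℝ => p + t • h) :=
    { contDiffOn := by fun_prop
      regular := fun t ht => by
        rw [(hd t).hasDerivWithinAt.derivWithin (uniqueDiffOn_Icc zero_lt_one t ht)]
        exact hh
      mem := fun t ht => hUΩ (hseg t ht)
      source := by simp
      target := by simp }
  refine ⟨by simpa using hreg.mem 1 (by simp), ?_⟩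
  refine (iInf₂_le _ hreg).trans (ENNReal.ofReal_le_ofReal ?_)
  unfold curveLength
  set g := fun t : ℝ => fderiv ℝ f (p + t • h) h with hg
  set D := f (p + h) - f p with hD
  have ig : IntervalIntegrable g volume 0 1 :=
    ContinuousOn.intervalIntegrable (by rwa [Set.uIcc_of_le zero_le_one])
  have eg : ∫ t in (0 : ℝ)..1, g t = D := by
    rw [intervalIntegral.integral_eq_sub_of_hasDerivAt (f := fun t : ℝ => f (p + t • h)) _ ig]
    · simp [hD]
    · rw [Set.uIcc_of_le zero_le_one]; exact hfd
  have e1 : ∫ t in (0 : ℝ)..1,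
        nuL2 (deriv (fun τ => f (p + τ • h)) t / ‖deriv (fun t : ℝ => p + t • h) t‖)
          * ‖deriv (fun t : ℝ => p + t • h) t‖
      = ∫ t in (0 : ℝ)..1, √(‖h‖ ^ 2 + g t ^ 2) := by
    refine intervalIntegral.integral_congr_Ioo_of_le zero_le_one fun t ht => ?_
    simp only [(hd t).deriv, (hfd t (Set.Ioo_subset_Icc_self ht)).deriv]
    exact nuL2_div_mul (norm_pos_iff.2 hh) _
  rw [e1]
  -- The square root is linearised by `2ρ√a ≤ ρ² + a`, and `g²` is replaced by `2Dg - D²` plus the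
  -- bound on `(g - D)²`. The result is affine in `g`, whose integral is `D`.
  have bound : ∀ t ∈ Set.Icc (0 : ℝ) 1, √(‖h‖ ^ 2 + g t ^ 2) ≤
      ρ / 2 + (‖h‖ ^ 2 - D ^ 2 + (K * ‖h‖ ^ 2) ^ 2) / (2 * ρ) + D / ρ * g t := by
    intro t ht
    have h1 : 2 * ρ * √(‖h‖ ^ 2 + g t ^ 2) ≤ ρ ^ 2 + (‖h‖ ^ 2 + g t ^ 2) := by
      have := Real.sq_sqrt (show 0 ≤ ‖h‖ ^ 2 + g t ^ 2 by positivity)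
      nlinarith [sq_nonneg (ρ - √(‖h‖ ^ 2 + g t ^ 2))]
    have h2 : (g t - D) ^ 2 ≤ (K * ‖h‖ ^ 2) ^ 2 := by
      rw [← sq_abs (g t - D)]
      exact pow_le_pow_left₀ (abs_nonneg _) (hK t ht) 2
    have h3 : 2 * ρ * (ρ / 2 + (‖h‖ ^ 2 - D ^ 2 + (K * ‖h‖ ^ 2) ^ 2) / (2 * ρ) + D / ρ * g t)
        = ρ ^ 2 + (‖h‖ ^ 2 - D ^ 2 + (K * ‖h‖ ^ 2) ^ 2) + 2 * D * g t := by
      field_simp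
    refine le_of_mul_le_mul_left (a := 2 * ρ) ?_ (by positivity)
    rw [h3]
    nlinarith
  calc ∫ t in (0 : ℝ)..1, √(‖h‖ ^ 2 + g t ^ 2)
      ≤ ∫ t in (0 : ℝ)..1,
        (ρ / 2 + (‖h‖ ^ 2 - D ^ 2 + (K * ‖h‖ ^ 2) ^ 2) / (2 * ρ) + D / ρ * g t) := by
        refine intervalIntegral.integral_mono_on zero_le_one ?_ ?_ bound
        · refine ContinuousOn.intervalIntegrable ?_
          rw [Set.uIcc_of_le zero_le_one]
          exact (continuousOn_const.add (hcont.pow 2)).sqrt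
        · exact intervalIntegrable_const.add (ig.const_mul _)
    _ = ρ / 2 + (‖h‖ ^ 2 - D ^ 2 + (K * ‖h‖ ^ 2) ^ 2) / (2 * ρ) + D / ρ * D := by
        rw [intervalIntegral.integral_add intervalIntegrable_const (ig.const_mul _),
          intervalIntegral.integral_const_mul, eg]
        simp
    _ ≤ ρ := by
        have : ρ / 2 + (‖h‖ ^ 2 - D ^ 2 + (K * ‖h‖ ^ 2) ^ 2) / (2 * ρ) + D / ρ * D
          = (ρ ^ 2 + (‖h‖ ^ 2 + D ^ 2 + K ^ 2 * ‖h‖ ^ 4)) / (2 * ρ) := by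
          field_simp
          ring
        rw [this, div_le_iff₀ (by positivity)]
        linarith

/-! ### The area-increasing perturbed reflection -/

theorem exists_bound_of_continuous {E : Type*} [NormedAddCommGroup E] [ProperSpace E]
    {g : E → ℝ} (hg : Continuous g) (R : ℝ) : ∃ B, 0 ≤ B ∧ ∀ z, ‖z‖ ≤ R → |g z| ≤ B := by
  obtain ⟨B, hB⟩ := (isCompact_closedBall (0 : E) R).exists_bound_of_continuousOn hg.continuousOn
  refine ⟨max B 0, le_max_right _ _, fun z hz => ?_⟩
  exact (hB z (by simpa using hz)).trans (le_max_left _ _)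

/-- A quadratic polynomial map of the plane has the Jacobian determinant given by its partial
derivatives. -/
theorem exists_hasFDerivAt_quadratic (p q : Fin 6 → ℝ) (z : ℝ × ℝ) :
    ∃ D : ℝ × ℝ →L[ℝ] ℝ × ℝ,
      HasFDerivAt (fun w : ℝ × ℝ =>
        (p 0 + p 1 * w.1 + p 2 * w.2 + p 3 * w.1 ^ 2 + p 4 * (w.1 * w.2) + p 5 * w.2 ^ 2,
          q 0 + q 1 * w.1 + q 2 * w.2 + q 3 * w.1 ^ 2 + q 4 * (w.1 * w.2) + q 5 * w.2 ^ 2)) D z ∧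
      D.det = (p 1 + 2 * p 3 * z.1 + p 4 * z.2) * (q 2 + q 4 * z.1 + 2 * q 5 * z.2)
        - (p 2 + p 4 * z.1 + 2 * p 5 * z.2) * (q 1 + 2 * q 3 * z.1 + q 4 * z.2) := by
  have key : ∀ p : Fin 6 → ℝ, HasFDerivAt (fun w : ℝ × ℝ =>
      p 0 + p 1 * w.1 + p 2 * w.2 + p 3 * w.1 ^ 2 + p 4 * (w.1 * w.2) + p 5 * w.2 ^ 2)
      ((p 1 + 2 * p 3 * z.1 + p 4 * z.2) • ContinuousLinearMap.fst ℝ ℝ ℝ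
        + (p 2 + p 4 * z.1 + 2 * p 5 * z.2) • ContinuousLinearMap.snd ℝ ℝ ℝ) z := by
    intro p
    have h1 : HasFDerivAt (fun w : ℝ × ℝ => w.1) (ContinuousLinearMap.fst ℝ ℝ ℝ) z :=
      hasFDerivAt_fst
    have h2 : HasFDerivAt (fun w : ℝ × ℝ => w.2) (ContinuousLinearMap.snd ℝ ℝ ℝ) z :=
      hasFDerivAt_snd
    have := (((((hasFDerivAt_const (p 0) z).add (h1.const_mul (p 1))).add
      (h2.const_mul (p 2))).add ((h1.pow 2).const_mul (p 3))).add
      ((h1.mul h2).const_mul (p 4))).add ((h2.pow 2).const_mul (p 5))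
    refine this.congr_fderiv ?_
    ext <;> simp <;> ring
  refine ⟨LinearMap.toContinuousLinearMap (Matrix.toLin (Module.Basis.finTwoProd ℝ)
    (Module.Basis.finTwoProd ℝ) !![p 1 + 2 * p 3 * z.1 + p 4 * z.2, p 2 + p 4 * z.1 + 2 * p 5 * z.2;
      q 1 + 2 * q 3 * z.1 + q 4 * z.2, q 2 + q 4 * z.1 + 2 * q 5 * z.2]), ?_, ?_⟩
  · rw [Matrix.toLin_finTwoProd_toContinuousLinearMap]
    exact (key p).prodMk (key q)
  · rw [LinearMap.det_toContinuousLinearMap, LinearMap.det_toLin, Matrix.det_fin_two_of]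

/-- Coefficients of the linear term `A x` and the quadratic term `b₁ x² + b₂ x y + b₃ y²` of one
function, and of the cubic term `c₁ x³ + c₂ x² y + c₃ x y² + c₄ y³` of another one. -/
structure Coeffs where
  (A b₁ b₂ b₃ c₁ c₂ c₃ c₄ : ℝ)

namespace Coeffs

variable (P : Coeffs)

noncomputable def quad (x y : ℝ) : ℝ := P.b₁ * x ^ 2 + P.b₂ * (x * y) + P.b₃ * y ^ 2

noncomputable def cubic (x y : ℝ) : ℝ :=
  P.c₁ * x ^ 3 + P.c₂ * (x ^ 2 * y) + P.c₃ * (x * y ^ 2) + P.c₄ * y ^ 3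

/-- The first-order displacement of the median. -/
noncomputable def shift : ℝ := P.b₃ / 3 - P.A * (2 * P.c₁ + P.c₃) / 6

/-- This is the value that makes the field below divergence-free for `δ = 0`. For `A ≠ 0` it also
equals `2·shift / A`; this coincidence of the two requirements determines the median displacement.
-/
noncomputable def k : ℝ := (2 * P.b₃ / P.A - P.c₃ - 2 * P.c₁) / 3

/-- First component of the correcting vector field; `δ` weighs an additional affine field. -/
noncomputable def fieldX (δ x y : ℝ) : ℝ :=
  P.k * (1 - x ^ 2) - (P.c₁ * x ^ 2 + P.c₂ * (x * y) + P.c₃ * y ^ 2)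
    - (2 * P.b₃ / P.A - P.c₃) * y ^ 2 + (P.c₂ + 2 * P.c₄) * (x * y) - δ * (3 * x - 4)

/-- Second component of the correcting vector field. -/
noncomputable def fieldY (δ x y : ℝ) : ℝ :=
  -P.k * (x * y) - P.c₄ * y ^ 2 - (P.c₂ + 2 * P.c₄) * x ^ 2
    + (2 * P.b₃ / P.A - P.c₃) * (x * y) + δ * y

/-- A perturbation of the point reflection. -/
noncomputable def reflect (ε δ : ℝ) (z : ℝ × ℝ) : ℝ × ℝ :=
  (-z.1 + ε * P.fieldX δ z.1 z.2, -z.2 + ε * P.fieldY δ z.1 z.2)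

/-- The Jacobian determinant of the correcting vector field. -/
noncomputable def fieldDet (δ x y : ℝ) : ℝ :=
  (-2 * P.k * x - 2 * P.c₁ * x - P.c₂ * y + (P.c₂ + 2 * P.c₄) * y - 3 * δ) *
      (-P.k * x - 2 * P.c₄ * y + (2 * P.b₃ / P.A - P.c₃) * x + δ) -
    (-P.c₂ * x - 2 * P.c₃ * y - 2 * (2 * P.b₃ / P.A - P.c₃) * y + (P.c₂ + 2 * P.c₄) * x) *
      (-P.k * y - 2 * (P.c₂ + 2 * P.c₄) * x + (2 * P.b₃ / P.A - P.c₃) * y)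

/-- For a plane field `V` one has `det (-1 + ε DV) = 1 - ε div V + ε² det DV`. By the choice of `k`
the divergence reduces to `-2δ`, the contribution of the affine field `(-(3x - 4), y)`. -/
theorem exists_hasFDerivAt_reflect (ε δ : ℝ) (z : ℝ × ℝ) :
    ∃ D : ℝ × ℝ →L[ℝ] ℝ × ℝ, HasFDerivAt (P.reflect ε δ) D z ∧
      D.det = 1 + 2 * ε * δ + ε ^ 2 * P.fieldDet δ z.1 z.2 := by
  obtain ⟨D, hD, hdet⟩ := exists_hasFDerivAt_quadratic
    ![ε * (P.k + 4 * δ), -1 - 3 * ε * δ, 0, ε * (-P.k - P.c₁), ε * (2 * P.c₄),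
      ε * (-(2 * P.b₃ / P.A))]
    ![0, 0, -1 + ε * δ, -ε * (P.c₂ + 2 * P.c₄), ε * (-P.k + (2 * P.b₃ / P.A - P.c₃)),
      -ε * P.c₄] z
  refine ⟨D, ?_, ?_⟩
  · refine hD.congr_of_eventuallyEq (Filter.Eventually.of_forall fun w => ?_)
    simp only [reflect, fieldX, fieldY]
    ext <;> simp <;> ring
  · rw [hdet]
    simp only [fieldDet, k]
    simp
    ring

theorem exists_field_bound : ∃ V, 0 ≤ V ∧ ∀ δ x y : ℝ, |δ| ≤ 2 → |x| ≤ 2 → |y| ≤ 2 →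
    |P.fieldX δ x y| ≤ V ∧ |P.fieldY δ x y| ≤ V ∧ |P.fieldDet δ x y| ≤ V := by
  obtain ⟨B1, h1, hB1⟩ := exists_bound_of_continuous
    (g := fun w : ℝ × ℝ × ℝ => P.fieldX w.1 w.2.1 w.2.2) (by unfold fieldX; fun_prop) 2
  obtain ⟨B2, h2, hB2⟩ := exists_bound_of_continuous
    (g := fun w : ℝ × ℝ × ℝ => P.fieldY w.1 w.2.1 w.2.2) (by unfold fieldY; fun_prop) 2
  obtain ⟨B3, h3, hB3⟩ := exists_bound_of_continuous
    (g := fun w : ℝ × ℝ × ℝ => P.fieldDet w.1 w.2.1 w.2.2) (by unfold fieldDet; fun_prop) 2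
  refine ⟨B1 + B2 + B3, by positivity, fun δ x y hδ hx hy => ?_⟩
  have hn : ‖(δ, x, y)‖ ≤ 2 := by simp [Prod.norm_def, hδ, hx, hy]
  have a1 := hB1 _ hn
  have a2 := hB2 _ hn
  have a3 := hB3 _ hn
  simp only at a1 a2 a3
  exact ⟨by linarith, by linarith, by linarith⟩

/-- The cubic form is odd, so its value at the perturbed reflection plus its value at the original
point is divisible by `ε`; the quotient is a polynomial, bounded on the box. -/
theorem exists_cubic_bound (V : ℝ) : ∃ W, 0 ≤ W ∧ ∀ ε x y v w : ℝ, 0 ≤ ε → ε ≤ 1 → |x| ≤ 2 →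
    |y| ≤ 2 → |v| ≤ V → |w| ≤ V → P.cubic (-x + ε * v) (-y + ε * w) ≤ -P.cubic x y + ε * W := by
  obtain ⟨B, h, hB⟩ := exists_bound_of_continuous
    (g := fun t : ℝ × ℝ × ℝ × ℝ × ℝ =>
      P.c₁ * (3 * t.2.1 ^ 2 * t.2.2.2.1 - 3 * t.2.1 * t.1 * t.2.2.2.1 ^ 2
        + t.1 ^ 2 * t.2.2.2.1 ^ 3)
      + P.c₂ * (t.2.1 ^ 2 * t.2.2.2.2 + (- 2 * t.2.1 * t.2.2.2.1 + t.1 * t.2.2.2.1 ^ 2)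
        * (-t.2.2.1 + t.1 * t.2.2.2.2))
      + P.c₃ * (t.2.2.1 ^ 2 * t.2.2.2.1 + (- 2 * t.2.2.1 * t.2.2.2.2 + t.1 * t.2.2.2.2 ^ 2)
        * (-t.2.1 + t.1 * t.2.2.2.1))
      + P.c₄ * (3 * t.2.2.1 ^ 2 * t.2.2.2.2 - 3 * t.2.2.1 * t.1 * t.2.2.2.2 ^ 2
        + t.1 ^ 2 * t.2.2.2.2 ^ 3)) (by fun_prop) (max 2 V)
  refine ⟨B, h, fun ε x y v w h0 h1 hx hy hv hw => ?_⟩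
  have hn : ‖(ε, x, y, v, w)‖ ≤ max 2 V := by
    simp only [Prod.norm_def, Real.norm_eq_abs, sup_le_iff]
    refine ⟨?_, hx.trans (le_max_left _ _), hy.trans (le_max_left _ _),
      hv.trans (le_max_right _ _), hw.trans (le_max_right _ _)⟩
    rw [abs_of_nonneg h0]
    linarith [le_max_left 2 V]
  have a := mul_le_mul_of_nonneg_left ((le_abs_self _).trans (hB _ hn)) h0
  simp only at a
  refine le_trans (le_of_eq ?_) (add_le_add_right a (-P.cubic x y))
  unfold cubic
  ring

theorem exists_quad_bound (V : ℝ) : ∃ W, 0 ≤ W ∧ ∀ ε x y v w : ℝ, 0 ≤ ε → ε ≤ 1 → |x| ≤ 2 →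
    |y| ≤ 2 → |v| ≤ V → |w| ≤ V → P.quad (-x + ε * v) (-y + ε * w) ≤ P.quad x y + ε * W := by
  obtain ⟨B, h, hB⟩ := exists_bound_of_continuous
    (g := fun t : ℝ × ℝ × ℝ × ℝ × ℝ =>
      P.b₁ * (- 2 * t.2.1 * t.2.2.2.1 + t.1 * t.2.2.2.1 ^ 2)
      + P.b₂ * (- t.2.1 * t.2.2.2.2 - t.2.2.1 * t.2.2.2.1 + t.1 * t.2.2.2.1 * t.2.2.2.2)
      + P.b₃ * (- 2 * t.2.2.1 * t.2.2.2.2 + t.1 * t.2.2.2.2 ^ 2)) (by fun_prop) (max 2 V)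
  refine ⟨B, h, fun ε x y v w h0 h1 hx hy hv hw => ?_⟩
  have hn : ‖(ε, x, y, v, w)‖ ≤ max 2 V := by
    simp only [Prod.norm_def, Real.norm_eq_abs, sup_le_iff]
    refine ⟨?_, hx.trans (le_max_left _ _), hy.trans (le_max_left _ _),
      hv.trans (le_max_right _ _), hw.trans (le_max_right _ _)⟩
    rw [abs_of_nonneg h0]
    linarith [le_max_left 2 V]
  have a := mul_le_mul_of_nonneg_left ((le_abs_self _).trans (hB _ hn)) h0
  simp only at a
  refine le_trans (le_of_eq ?_) (add_le_add_right a (P.quad x y))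
  unfold quad
  ring

theorem exists_field_lipschitz : ∃ W, 0 ≤ W ∧ ∀ δ x y x' y' : ℝ, |δ| ≤ 2 → |x| ≤ 2 → |y| ≤ 2 →
    |x'| ≤ 2 → |y'| ≤ 2 →
    |P.fieldX δ x y - P.fieldX δ x' y'| ≤ W * (|x - x'| + |y - y'|) ∧
    |P.fieldY δ x y - P.fieldY δ x' y'| ≤ W * (|x - x'| + |y - y'|) := by
  obtain ⟨B1, h1, hB1⟩ := exists_bound_of_continuous
    (g := fun t : ℝ × ℝ × ℝ × ℝ × ℝ => (-P.k - P.c₁) * (t.2.1 + t.2.2.2.1)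
      + 2 * P.c₄ * t.2.2.1 - 3 * t.1) (by fun_prop) 2
  obtain ⟨B2, h2, hB2⟩ := exists_bound_of_continuous
    (g := fun t : ℝ × ℝ × ℝ × ℝ × ℝ => -(2 * P.b₃ / P.A) * (t.2.2.1 + t.2.2.2.2)
      + 2 * P.c₄ * t.2.2.2.1) (by fun_prop) 2
  obtain ⟨B3, h3, hB3⟩ := exists_bound_of_continuous
    (g := fun t : ℝ × ℝ × ℝ × ℝ × ℝ => -(P.c₂ + 2 * P.c₄) * (t.2.1 + t.2.2.2.1)
      + (-P.k + (2 * P.b₃ / P.A - P.c₃)) * t.2.2.1) (by fun_prop) 2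
  obtain ⟨B4, h4, hB4⟩ := exists_bound_of_continuous
    (g := fun t : ℝ × ℝ × ℝ × ℝ × ℝ => -P.c₄ * (t.2.2.1 + t.2.2.2.2)
      + (-P.k + (2 * P.b₃ / P.A - P.c₃)) * t.2.2.2.1 + t.1) (by fun_prop) 2
  refine ⟨B1 + B2 + B3 + B4, by positivity, fun δ x y x' y' hδ hx hy hx' hy' => ?_⟩
  have hn : ‖(δ, x, y, x', y')‖ ≤ 2 := by simp [Prod.norm_def, hδ, hx, hy, hx', hy']
  have aux : ∀ {g h a b : ℝ} (_ : |g| ≤ a) (_ : |h| ≤ b) (_ : a ≤ B1 + B2 + B3 + B4)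
      (_ : b ≤ B1 + B2 + B3 + B4),
      |g * (x - x') + h * (y - y')| ≤ (B1 + B2 + B3 + B4) * (|x - x'| + |y - y'|) := by
    intro g h a b hg hh ha hb
    refine (abs_add_le _ _).trans ?_
    rw [abs_mul, abs_mul, mul_add]
    have := mul_le_mul_of_nonneg_right (hg.trans ha) (abs_nonneg (x - x'))
    have := mul_le_mul_of_nonneg_right (hh.trans hb) (abs_nonneg (y - y'))
    linarith
  constructor
  · refine le_trans (le_of_eq ?_) (aux (hB1 _ hn) (hB2 _ hn) (by linarith) (by linarith))
    congr 1
    unfold fieldX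
    ring
  · refine le_trans (le_of_eq ?_) (aux (hB3 _ hn) (hB4 _ hn) (by linarith) (by linarith))
    congr 1
    unfold fieldY
    ring

end Coeffs

namespace Coeffs

variable (P : Coeffs)

/-- The linear factor of `x` in the first-order change of `U` under the reflection. -/
noncomputable def slope (x y : ℝ) : ℝ :=
  -P.k * x - P.c₁ * x - P.c₂ * y + (P.c₂ + 2 * P.c₄) * y + 2 * (P.b₁ * x + P.b₂ * y) / P.A

/-- For `δ = 0` the term `2·shift - 2·quad` reflects the values of `U` about `ε·shift` to first
order. The remaining error carries a factor `x`, hence is harmless near the level line. -/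
theorem A_mul_fieldX (hA : 0 < P.A) (δ x y : ℝ) :
    P.A * P.fieldX δ x y = 2 * P.shift - 2 * P.quad x y + P.A * x * P.slope x y
      - P.A * δ * (3 * x - 4) := by
  unfold fieldX shift quad slope k
  field_simp
  ring

/-- The radial component `-cubic` turns the perturbed circle into itself under the reflection, where
the cubic form changes sign. The `k`-term vanishes on the unit circle. -/
theorem mul_field (δ x y : ℝ) : x * P.fieldX δ x y + y * P.fieldY δ x y =
    -P.cubic x y + P.k * x * (1 - x ^ 2 - y ^ 2) - δ * (3 * x ^ 2 - 4 * x - y ^ 2) := by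
  unfold fieldX fieldY cubic
  ring

/-- To first order the reflection preserves the level `Q = 1`. All second-order errors are beaten by
the affine field, which lowers `Q` by an amount proportional to `K ε²`. -/
theorem reflect_level_le {Q' ε C₀ K V W B x y : ℝ} (hε : 0 < ε) (hε1 : ε ≤ 1) (hC₀ : 0 ≤ C₀)
    (hB : 0 ≤ B)
    (hx : -(1 / 10) ≤ x) (hx' : x ≤ 11 / 10)
    (hvX : |P.fieldX (K * ε) x y| ≤ V) (hvY : |P.fieldY (K * ε) x y| ≤ V)
    (hc : |P.cubic x y| ≤ B) (hkc : |2 * P.k * x * P.cubic x y| ≤ B)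
    (hcub : P.cubic (-x + ε * P.fieldX (K * ε) x y) (-y + ε * P.fieldY (K * ε) x y)
      ≤ -P.cubic x y + ε * W)
    (hK : 2 * (4 * C₀ + 2 * B + 2 * V ^ 2 + W) ≤ K) (hK0 : 0 ≤ K)
    (hKε : K * ε ≤ 1 / 8) (hk : 4 * |P.k| * ε ≤ 1 / 4) (hBε : ε * B ≤ 1 / 4)
    (hQ : x ^ 2 + y ^ 2 + ε * P.cubic x y ≤ 1 + C₀ * ε ^ 2)
    (hQ' : Q' ≤ (-x + ε * P.fieldX (K * ε) x y) ^ 2 + (-y + ε * P.fieldY (K * ε) x y) ^ 2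
      + ε * P.cubic (-x + ε * P.fieldX (K * ε) x y) (-y + ε * P.fieldY (K * ε) x y)
      + C₀ * ε ^ 2) :
    Q' ≤ 1 - C₀ * ε ^ 2 := by
  have hm := P.mul_field (K * ε) x y
  set v := P.fieldX (K * ε) x y
  set w := P.fieldY (K * ε) x y
  set c := P.cubic x y
  set σ := 1 - (x ^ 2 + y ^ 2 + ε * c) with hσ
  have hσ0 : -(C₀ * ε ^ 2) ≤ σ := by linarith
  have hv2 : v ^ 2 ≤ V ^ 2 := by rw [← sq_abs]; exact pow_le_pow_left₀ (abs_nonneg _) hvX 2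
  have hw2 : w ^ 2 ≤ V ^ 2 := by rw [← sq_abs]; exact pow_le_pow_left₀ (abs_nonneg _) hvY 2
  have hcub' := mul_le_mul_of_nonneg_left hcub hε.le
  have hvw := mul_le_mul_of_nonneg_left (add_le_add hv2 hw2) (sq_nonneg ε)
  have e1 : Q' ≤ 1 - σ - 2 * ε * P.k * x * (1 - x ^ 2 - y ^ 2)
      + 2 * K * ε ^ 2 * (3 * x ^ 2 - 4 * x - y ^ 2) + ε ^ 2 * (2 * V ^ 2 + W + C₀) := by
    have e2 : (-x + ε * v) ^ 2 + (-y + ε * w) ^ 2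
        = x ^ 2 + y ^ 2 - 2 * ε * (x * v + y * w) + ε ^ 2 * (v ^ 2 + w ^ 2) := by ring
    rw [e2, hm] at hQ'
    rw [hσ]
    linarith
  -- Equivalent to `4x² - 4x ≤ 1/2`; this is where the bounds `-1/10 ≤ x ≤ 11/10` are needed (the
  -- left side is at most `0.44`).
  have e3 : 3 * x ^ 2 - 4 * x - y ^ 2 ≤ σ + ε * c - 1 / 2 := by
    rw [hσ]
    nlinarith
  have e4 := mul_le_mul_of_nonneg_left e3 (show 0 ≤ 2 * K * ε ^ 2 by positivity)
  have hcB := (le_abs_self c).trans hc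
  have hkcB := (neg_abs_le (2 * P.k * x * c))
  have e5 : 2 * K * ε ^ 2 * (ε * c) ≤ K * ε ^ 2 * (1 / 2) := by
    have : ε * c ≤ 1 / 4 := (mul_le_mul_of_nonneg_left hcB hε.le).trans hBε
    have := mul_le_mul_of_nonneg_left this (show 0 ≤ 2 * K * ε ^ 2 by positivity)
    linarith
  have e6 : -(ε ^ 2 * (2 * P.k * x * c)) ≤ ε ^ 2 * B := by
    have := mul_le_mul_of_nonneg_left (show -(2 * P.k * x * c) ≤ B by linarith) (sq_nonneg ε)
    linarith
  have e7 : 1 - x ^ 2 - y ^ 2 = σ + ε * c := by rw [hσ]; ring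
  rw [e7] at e1
  have hcoef : 0 ≤ 1 + 2 * ε * P.k * x - 2 * K * ε ^ 2 ∧
      1 + 2 * ε * P.k * x - 2 * K * ε ^ 2 ≤ 2 := by
    have a1 : |2 * ε * P.k * x| ≤ 1 / 4 := by
      rw [abs_mul, abs_mul, abs_mul, abs_two, abs_of_pos hε]
      have : |x| ≤ 2 := abs_le.2 ⟨by linarith, by linarith⟩
      have := mul_le_mul_of_nonneg_left this (show 0 ≤ 2 * ε * |P.k| by positivity)
      linarith
    have a2 := abs_le.1 a1
    have a3 : 0 ≤ K * ε ^ 2 := by positivity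
    have a4 : K * ε ^ 2 ≤ 1 / 8 := by nlinarith
    constructor <;> linarith [a2.1, a2.2]
  have e8 : -(σ * (1 + 2 * ε * P.k * x - 2 * K * ε ^ 2)) ≤ 2 * (C₀ * ε ^ 2) := by
    have := mul_le_mul_of_nonneg_right hσ0 hcoef.1
    have := mul_le_mul_of_nonneg_left hcoef.2 (show 0 ≤ C₀ * ε ^ 2 by positivity)
    linarith
  have e9 := mul_le_mul_of_nonneg_left hK (sq_nonneg ε)
  have e10 : 0 ≤ ε ^ 2 * B := by positivity
  linarith

/-- The bound `U ≥ ε·shift + C₁ε²` yields a lower bound on `A x`. Multiplied by the positive factor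
`1 - ε·slope`, it bounds the reflected value from above. The cost `10 A K ε²` of the affine field,
where `-(3x - 4) ≤ 10`, is absorbed by `C₁`. -/
theorem reflect_value_lt {U U' ε C₀ C₁ K S B BL x y : ℝ} (hA : 0 < P.A) (hε : 0 < ε)
    (hC₀ : 0 ≤ C₀) (hC₁ : 0 ≤ C₁)
    (hx : |x| ≤ 2) (hK0 : 0 ≤ K)
    (hL : |P.slope x y| ≤ BL) (hBL : ε * BL ≤ 1 / 2)
    (hLq : |P.slope x y * (P.shift - P.quad x y)| ≤ B)
    (hquad : P.quad (-x + ε * P.fieldX (K * ε) x y) (-y + ε * P.fieldY (K * ε) x y)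
      ≤ P.quad x y + ε * S)
    (hU1 : U ≤ P.A * x + ε * P.quad x y + C₀ * ε ^ 2)
    (hU : ε * P.shift + C₁ * ε ^ 2 ≤ U)
    (hU' : U' ≤ P.A * (-x + ε * P.fieldX (K * ε) x y)
      + ε * P.quad (-x + ε * P.fieldX (K * ε) x y) (-y + ε * P.fieldY (K * ε) x y) + C₀ * ε ^ 2)
    (hC : 10 * P.A * K + S + 3 * C₀ + B < C₁) :
    U' < ε * P.shift + C₁ * ε ^ 2 := by
  have hm := P.A_mul_fieldX hA (K * ε) x y
  set v := P.fieldX (K * ε) x y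
  set w := P.fieldY (K * ε) x y
  set b := P.quad x y
  set κ := P.shift
  set L := P.slope x y
  have hx2 := abs_le.1 hx
  have hεL : |ε * L| ≤ 1 / 2 := by
    rw [abs_mul, abs_of_pos hε]
    exact (mul_le_mul_of_nonneg_left hL hε.le).trans hBL
  have hεL' := abs_le.1 hεL
  have h1 := mul_le_mul_of_nonneg_left hquad hε.le
  have h2 : ε * κ + C₁ * ε ^ 2 - ε * b - C₀ * ε ^ 2 ≤ P.A * x := by linarith
  have h3 := mul_le_mul_of_nonneg_left h2 (show 0 ≤ 1 - ε * L by linarith)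
  have h4 : ε * (P.A * v) ≤ ε * (2 * κ - 2 * b + P.A * x * L) + 10 * P.A * K * ε ^ 2 := by
    rw [hm]
    have : -(P.A * K * ε ^ 2 * (3 * x - 4)) ≤ P.A * K * ε ^ 2 * 10 := by
      have := mul_le_mul_of_nonneg_left (show -(3 * x - 4) ≤ 10 by linarith)
        (show 0 ≤ P.A * K * ε ^ 2 by positivity)
      linarith
    linarith
  have h5 : ε ^ 2 * (L * (κ - b)) ≤ ε ^ 2 * B :=
    mul_le_mul_of_nonneg_left ((le_abs_self _).trans hLq) (sq_nonneg ε)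
  have h6 : ε * L * (C₁ * ε ^ 2) ≤ C₁ * ε ^ 2 :=
    mul_le_of_le_one_left (by positivity) (by linarith)
  have h7 : -(ε * L * (C₀ * ε ^ 2)) ≤ C₀ * ε ^ 2 := by
    have := mul_le_of_le_one_left (show 0 ≤ C₀ * ε ^ 2 by positivity)
      (show -(ε * L) ≤ 1 by linarith)
    linarith
  have h8 := mul_lt_mul_of_pos_left hC (show 0 < ε ^ 2 by positivity)
  linarith

/-- For small `ε` the points to be reflected lie in a slight enlargement of the right half of the
unit disc, the region where the affine field has the desired effect. -/
theorem mem_box {U Q ε C₀ C₁ B D x y : ℝ} (hA : 0 < P.A) (hε : 0 < ε) (hε1 : ε ≤ 1)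
    (hC₀ : 0 ≤ C₀) (hC₁ : 0 ≤ C₁)
    (hU : |U - (P.A * x + ε * P.quad x y)| ≤ C₀ * ε ^ 2)
    (hQ : |Q - (x ^ 2 + y ^ 2 + ε * P.cubic x y)| ≤ C₀ * ε ^ 2)
    (hQ1 : Q ≤ 1) (hU1 : ε * P.shift + C₁ * ε ^ 2 ≤ U)
    (hB : |P.cubic x y| ≤ B) (hD : |P.shift - P.quad x y| ≤ D)
    (hεD : ε * (D + C₀) ≤ P.A / 10) (hεB : ε * (C₀ + B) ≤ 1 / 10) :
    -(1 / 10) ≤ x ∧ x ≤ 11 / 10 ∧ |y| ≤ 11 / 10 ∧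
      x ^ 2 + y ^ 2 + ε * P.cubic x y ≤ 1 + C₀ * ε ^ 2 := by
  have hC₀ε : C₀ * ε ^ 2 ≤ ε * C₀ := by nlinarith [mul_nonneg hC₀ hε.le]
  have hu := (abs_le.1 hU).2
  have hq := (abs_le.1 hQ).1
  have hb := mul_le_mul_of_nonneg_left (abs_le.1 hB).1 hε.le
  have hd := mul_le_mul_of_nonneg_left (abs_le.1 hD).1 hε.le
  have hsq : x ^ 2 + y ^ 2 ≤ (11 / 10) ^ 2 := by linarith
  have hx2 := sq_nonneg x
  have hy2 := sq_nonneg y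
  refine ⟨?_, (abs_le_of_sq_le_sq' (by linarith) (by norm_num)).2,
    abs_le_of_sq_le_sq (by linarith) (by norm_num), by linarith⟩
  have : 0 ≤ C₁ * ε ^ 2 := by positivity
  have : P.A * (-(1 / 10)) ≤ P.A * x := by linarith
  exact le_of_mul_le_mul_left this hA

/-- A point reflection plus a perturbation of Lipschitz constant less than one in the sum norm is
injective. -/
theorem injOn_reflect {ε δ H : ℝ} (hε : 0 < ε) (hH : 2 * (ε * H) < 1) {S : Set (ℝ × ℝ)}
    (hL : ∀ z ∈ S, ∀ z' ∈ S,
      |P.fieldX δ z.1 z.2 - P.fieldX δ z'.1 z'.2| ≤ H * (|z.1 - z'.1| + |z.2 - z'.2|) ∧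
      |P.fieldY δ z.1 z.2 - P.fieldY δ z'.1 z'.2| ≤ H * (|z.1 - z'.1| + |z.2 - z'.2|)) :
    Set.InjOn (P.reflect ε δ) S := by
  intro z hz z' hz' heq
  obtain ⟨l1, l2⟩ := hL z hz z' hz'
  simp only [reflect, Prod.mk.injEq] at heq
  have aux : ∀ {a v l : ℝ}, a = ε * v → |v| ≤ l → |a| ≤ ε * l := by
    intro a v l ha hv
    rw [ha, abs_mul, abs_of_pos hε]
    exact mul_le_mul_of_nonneg_left hv hε.le
  have e1 := aux (a := z.1 - z'.1) (by linarith [heq.1]) l1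
  have e2 := aux (a := z.2 - z'.2) (by linarith [heq.2]) l2
  have e3 : |z.1 - z'.1| + |z.2 - z'.2| ≤ 0 := by
    by_contra! hpos
    have := mul_lt_mul_of_pos_right hH hpos
    linarith
  have a1 := abs_nonneg (z.1 - z'.1)
  have a2 := abs_nonneg (z.2 - z'.2)
  exact Prod.ext (sub_eq_zero.1 (abs_eq_zero.1 (by linarith)))
    (sub_eq_zero.1 (abs_eq_zero.1 (by linarith)))

/-- For small `ε > 0`, the perturbed reflection carries the part of `{Q ≤ 1}` where `U` exceeds
the displaced median into the part of a slightly smaller set where `U` stays below, and it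
increases area. -/
theorem exists_area_increasing_reflection (hA : 0 < P.A) {C₀ : ℝ} (hC₀ : 0 ≤ C₀) :
    ∃ C₁ K ε₀ : ℝ, 0 ≤ C₁ ∧ 0 < K ∧ 0 < ε₀ ∧ ∀ ε : ℝ, 0 < ε → ε < ε₀ → ∀ U Q : ℝ × ℝ → ℝ,
      (∀ z, ‖z‖ ≤ 2 → |U z - (P.A * z.1 + ε * P.quad z.1 z.2)| ≤ C₀ * ε ^ 2) →
      (∀ z, ‖z‖ ≤ 2 → |Q z - (z.1 ^ 2 + z.2 ^ 2 + ε * P.cubic z.1 z.2)| ≤ C₀ * ε ^ 2) →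
      ∀ S : Set (ℝ × ℝ), MeasurableSet S →
        (∀ z ∈ S, ‖z‖ ≤ 2 ∧ Q z ≤ 1 ∧ ε * P.shift + C₁ * ε ^ 2 ≤ U z) →
        ∃ T : Set (ℝ × ℝ),
          (∀ z ∈ T, ‖z‖ ≤ 2 ∧ Q z ≤ 1 - C₀ * ε ^ 2 ∧ U z < ε * P.shift + C₁ * ε ^ 2) ∧
          ENNReal.ofReal (1 + K * ε ^ 2) * volume S ≤ volume T := by
  obtain ⟨V, hV, hVb⟩ := P.exists_field_bound
  obtain ⟨W, hW, hWb⟩ := P.exists_cubic_bound V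
  obtain ⟨S₀, hS₀, hSb⟩ := P.exists_quad_bound V
  obtain ⟨H, hH, hHb⟩ := P.exists_field_lipschitz
  obtain ⟨B1, hB1, hB1b⟩ := exists_bound_of_continuous
    (g := fun z : ℝ × ℝ => P.cubic z.1 z.2) (by unfold cubic; fun_prop) 2
  obtain ⟨B2, hB2, hB2b⟩ := exists_bound_of_continuous
    (g := fun z : ℝ × ℝ => 2 * P.k * z.1 * P.cubic z.1 z.2) (by unfold cubic; fun_prop) 2
  obtain ⟨B3, hB3, hB3b⟩ := exists_bound_of_continuous
    (g := fun z : ℝ × ℝ => P.slope z.1 z.2) (by unfold slope; fun_prop) 2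
  obtain ⟨B4, hB4, hB4b⟩ := exists_bound_of_continuous
    (g := fun z : ℝ × ℝ => P.slope z.1 z.2 * (P.shift - P.quad z.1 z.2))
    (by unfold slope quad; fun_prop) 2
  obtain ⟨B5, hB5, hB5b⟩ := exists_bound_of_continuous
    (g := fun z : ℝ × ℝ => P.shift - P.quad z.1 z.2) (by unfold quad; fun_prop) 2
  -- The first summand pays for the errors in `Q`. The summand `V` bounds the second-order part of
  -- the Jacobian, so that `2Kε² - Vε² ≥ Kε²` of the area gain remains.
  obtain ⟨K, hK⟩ : ∃ K, K = 2 * (4 * C₀ + 2 * (B1 + B2) + 2 * V ^ 2 + W) + V + 1 := ⟨_, rfl⟩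
  have hK0 : 0 < K := by rw [hK]; positivity
  have hVK : V ≤ K := by
    have : 0 ≤ 2 * (4 * C₀ + 2 * (B1 + B2) + 2 * V ^ 2 + W) := by positivity
    linarith
  have hK' : 2 * (4 * C₀ + 2 * (B1 + B2) + 2 * V ^ 2 + W) ≤ K := by linarith
  -- `C₁` is chosen after `K`, since the affine field raises the reflected values of `U`.
  obtain ⟨C₁, hC₁⟩ : ∃ C₁, C₁ = 10 * P.A * K + S₀ + 3 * C₀ + B4 + 1 := ⟨_, rfl⟩
  have hC₁0 : 0 ≤ C₁ := by rw [hC₁]; positivity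
  have hC₁' : 10 * P.A * K + S₀ + 3 * C₀ + B4 < C₁ := by linarith
  clear hK hC₁
  have hsmall : ∀ᶠ ε in nhdsWithin (0 : ℝ) (Set.Ioi 0), ε < 1 ∧ K * ε < 1 / 8 ∧
      4 * |P.k| * ε < 1 / 4 ∧ ε * (B1 + B2) < 1 / 4 ∧ ε * B3 < 1 / 2 ∧
      ε * (B5 + C₀) < P.A / 10 ∧ ε * (C₀ + B1) < 1 / 10 ∧ ε * V < 1 / 2 ∧
      2 * (ε * H) < 1 := by
    have aux : ∀ {g : ℝ → ℝ} {a : ℝ}, Continuous g → g 0 < a →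
        ∀ᶠ ε in nhdsWithin (0 : ℝ) (Set.Ioi 0), g ε < a := fun hg h =>
      (hg.continuousAt.eventually_lt_const h).filter_mono nhdsWithin_le_nhds
    refine (aux (by fun_prop) ?_).and <| (aux (by fun_prop) ?_).and <|
      (aux (by fun_prop) ?_).and <| (aux (by fun_prop) ?_).and <| (aux (by fun_prop) ?_).and <|
      (aux (by fun_prop) ?_).and <| (aux (by fun_prop) ?_).and <| (aux (by fun_prop) ?_).and
      (aux (by fun_prop) ?_)
    all_goals first | simp; done | (simp; exact hA)
  obtain ⟨ε₀, hε₀, hsmall⟩ := (mem_nhdsGT_iff_exists_Ioo_subset.1 hsmall)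
  refine ⟨C₁, K, ε₀, hC₁0, hK0, hε₀, ?_⟩
  intro ε hε hεε₀ U Q hU hQ S hS hSsub
  obtain ⟨hε1, s1, s2, s3, s4, s5, s6, s7, s8⟩ := hsmall ⟨hε, hεε₀⟩
  have hδ : |K * ε| ≤ 2 := by rw [abs_of_pos (by positivity)]; linarith
  have hcoord : ∀ z ∈ S, |z.1| ≤ 2 ∧ |z.2| ≤ 2 := fun z hz =>
    ⟨(norm_fst_le z).trans (hSsub z hz).1, (norm_snd_le z).trans (hSsub z hz).1⟩
  have hbox : ∀ z ∈ S, -(1 / 10) ≤ z.1 ∧ z.1 ≤ 11 / 10 ∧ |z.2| ≤ 11 / 10 ∧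
      z.1 ^ 2 + z.2 ^ 2 + ε * P.cubic z.1 z.2 ≤ 1 + C₀ * ε ^ 2 := by
    intro z hz
    obtain ⟨h1, h2, h3⟩ := hSsub z hz
    exact P.mem_box hA hε hε1.le hC₀ hC₁0 (hU z h1) (hQ z h1) h2 h3 (hB1b z h1) (hB5b z h1)
      s5.le s6.le
  set M := P.reflect ε (K * ε) with hM
  refine ⟨M '' S, ?_, ?_⟩
  · rintro _ ⟨z, hz, rfl⟩
    obtain ⟨hz1, hz2, hz3⟩ := hSsub z hz
    obtain ⟨hc1, hc2⟩ := hcoord z hz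
    obtain ⟨g1, g2, g3, g4⟩ := hbox z hz
    obtain ⟨v1, v2, -⟩ := hVb (K * ε) z.1 z.2 hδ hc1 hc2
    have hMz : ‖M z‖ ≤ 2 := by
      have aux : ∀ {a v : ℝ}, |a| ≤ 11 / 10 → |v| ≤ V → |-a + ε * v| ≤ 2 := by
        intro a v ha hv
        refine (abs_add_le _ _).trans ?_
        rw [abs_neg, abs_mul, abs_of_pos hε]
        linarith [mul_le_mul_of_nonneg_left hv hε.le]
      rw [Prod.norm_def, sup_le_iff]
      exact ⟨aux (abs_le.2 ⟨by linarith, g2⟩) v1, aux g3 v2⟩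
    refine ⟨hMz, ?_, ?_⟩
    · refine P.reflect_level_le (K := K) (V := V) (W := W) (B := B1 + B2) hε hε1.le hC₀
        (by positivity) g1 g2 v1 v2 ((hB1b z hz1).trans (by linarith))
        ((hB2b z hz1).trans (by linarith)) (hWb ε z.1 z.2 _ _ hε.le hε1.le hc1 hc2 v1 v2)
        hK' hK0.le s1.le s2.le s3.le g4 ?_
      have := (abs_le.1 (hQ _ hMz)).2
      simp only [hM, reflect] at this ⊢
      linarith
    · refine P.reflect_value_lt (K := K) (S := S₀) (B := B4) (BL := B3) (U := U z) hA hε hC₀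
        hC₁0 hc1 hK0.le (hB3b z hz1) s4.le (hB4b z hz1)
        (hSb ε z.1 z.2 _ _ hε.le hε1.le hc1 hc2 v1 v2) ?_ hz3 ?_ hC₁'
      · linarith [(abs_le.1 (hU z hz1)).2]
      · have := (abs_le.1 (hU _ hMz)).2
        simp only [hM, reflect] at this ⊢
        linarith
  · have hinj : Set.InjOn M S := P.injOn_reflect hε s8 fun z hz z' hz' =>
      hHb (K * ε) z.1 z.2 z'.1 z'.2 hδ (hcoord z hz).1 (hcoord z hz).2 (hcoord z' hz').1
        (hcoord z' hz').2
    choose D hD hdet using fun z => P.exists_hasFDerivAt_reflect ε (K * ε) z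
    rw [← lintegral_abs_det_fderiv_eq_addHaar_image volume hS
      (fun z _ => (hD z).hasFDerivWithinAt) hinj, ← setLIntegral_const]
    refine setLIntegral_mono' hS fun z hz => ENNReal.ofReal_le_ofReal ?_
    obtain ⟨hc1, hc2⟩ := hcoord z hz
    have v3 := (abs_le.1 (hVb (K * ε) z.1 z.2 hδ hc1 hc2).2.2).1
    refine le_trans ?_ (le_abs_self _)
    rw [hdet]
    have := mul_le_mul_of_nonneg_left (show -K ≤ P.fieldDet (K * ε) z.1 z.2 by linarith)
      (sq_nonneg ε)
    linarith

end Coeffs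

/-! ### Taylor bounds and the adapted frame -/

/-- Second-order Taylor expansions of a function and of its derivative, with explicit orders of
the remainders. -/
theorem exists_taylor_bounds {E : Type*} [NormedAddCommGroup E] [NormedSpace ℝ E] {f : E → ℝ}
    {x₀ : E} (hf : ContDiffAt ℝ 3 f x₀) :
    ∃ C r : ℝ, 0 ≤ C ∧ 0 < r ∧ ∀ h : E, ‖h‖ ≤ r →
      ‖fderiv ℝ f (x₀ + h) - fderiv ℝ f x₀ - fderiv ℝ (fderiv ℝ f) x₀ h‖ ≤ C * ‖h‖ ^ 2 ∧
      |f (x₀ + h) - f x₀ - fderiv ℝ f x₀ h - fderiv ℝ (fderiv ℝ f) x₀ h h / 2|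
        ≤ C * ‖h‖ ^ 3 := by
  have hg : ContDiffAt ℝ 2 (fderiv ℝ f) x₀ := hf.fderiv_right (m := 2) (by norm_cast)
  have hg' : ContDiffAt ℝ 1 (fderiv ℝ (fderiv ℝ f)) x₀ := hg.fderiv_right (m := 1) (by norm_cast)
  have hsymm : IsSymmSndFDerivAt ℝ f x₀ := hf.isSymmSndFDerivAt (by simp; norm_cast)
  obtain ⟨K, t, ht, hK⟩ := hg'.exists_lipschitzOnWith
  have hev := (hf.eventually (by simp)).and ((hg.eventually (by simp)).and ht)
  obtain ⟨r, hr, hball⟩ := Metric.eventually_nhds_iff_ball.1 hev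
  set g := fderiv ℝ f
  set g' := fderiv ℝ g
  have hnear : ∀ h : E, ‖h‖ ≤ r / 2 → ∀ x ∈ Metric.closedBall x₀ ‖h‖, x ∈ Metric.ball x₀ r := by
    intro h hh x hx
    rw [Metric.mem_closedBall] at hx
    rw [Metric.mem_ball]
    linarith
  -- The second derivative is locally Lipschitz, so the mean value inequality for `g` minus its
  -- linear part gives one power of `‖h‖` more; repeating this for `f` gives the cubic remainder.
  have h1 : ∀ h : E, ‖h‖ ≤ r / 2 → ‖g (x₀ + h) - g x₀ - g' x₀ h‖ ≤ K * ‖h‖ ^ 2 := by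
    intro h hh
    have hd : ∀ x ∈ Metric.closedBall x₀ ‖h‖,
        HasFDerivWithinAt (fun x => g x - g' x₀ x) (g' x - g' x₀) (Metric.closedBall x₀ ‖h‖) x := by
      intro x hx
      have := ((hball x (hnear h hh x hx)).2.1.differentiableAt (by simp)).hasFDerivAt
      exact (this.sub (g' x₀).hasFDerivAt).hasFDerivWithinAt
    have hb : ∀ x ∈ Metric.closedBall x₀ ‖h‖, ‖g' x - g' x₀‖ ≤ K * ‖h‖ := by
      intro x hx
      have := hK.norm_sub_le (hball x (hnear h hh x hx)).2.2
        (hball x₀ (Metric.mem_ball_self hr)).2.2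
      refine this.trans (mul_le_mul_of_nonneg_left ?_ K.2)
      rwa [← dist_eq_norm]
    have := (convex_closedBall x₀ ‖h‖).norm_image_sub_le_of_norm_hasFDerivWithin_le hd hb
      (Metric.mem_closedBall_self (norm_nonneg h)) (y := x₀ + h) (by simp)
    simp only [map_add, add_sub_cancel_left] at this
    refine le_trans (le_of_eq ?_) (this.trans (le_of_eq (by ring)))
    congr 1
    abel
  refine ⟨K, r / 2, K.2, by positivity, fun h hh => ⟨h1 h hh, ?_⟩⟩
  have hd : ∀ x ∈ Metric.closedBall x₀ ‖h‖,
      HasFDerivWithinAt (fun x => f x - g x₀ x - g' x₀ (x - x₀) (x - x₀) / 2)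
        (g x - g x₀ - g' x₀ (x - x₀)) (Metric.closedBall x₀ ‖h‖) x := by
    intro x hx
    have d1 := ((hball x (hnear h hh x hx)).1.differentiableAt (by simp)).hasFDerivAt
    have d2 : HasFDerivAt (fun x => x - x₀) (ContinuousLinearMap.id ℝ E) x :=
      (hasFDerivAt_id x).sub_const x₀
    have d3 : HasFDerivAt (fun x => g' x₀ (x - x₀)) ((g' x₀).comp (ContinuousLinearMap.id ℝ E)) x :=
      (g' x₀).hasFDerivAt.comp x d2
    have d4 := (d3.clm_apply d2).mul_const (2⁻¹ : ℝ)
    have d5 := (d1.sub (g x₀).hasFDerivAt).sub d4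
    simp only [div_eq_mul_inv]
    refine (d5.congr_fderiv ?_).hasFDerivWithinAt
    ext v
    have := hsymm v (x - x₀)
    simp only [sub_apply, smul_apply,
      add_apply, ContinuousLinearMap.comp_apply,
      ContinuousLinearMap.id_apply, ContinuousLinearMap.flip_apply, smul_eq_mul] at this ⊢
    change g x v - g x₀ v - 2⁻¹ * (g' x₀ (x - x₀) v + g' x₀ v (x - x₀)) = _
    rw [show g' x₀ v (x - x₀) = g' x₀ (x - x₀) v from this]
    ring
  have hb : ∀ x ∈ Metric.closedBall x₀ ‖h‖, ‖g x - g x₀ - g' x₀ (x - x₀)‖ ≤ K * ‖h‖ ^ 2 := by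
    intro x hx
    have hx' : ‖x - x₀‖ ≤ ‖h‖ := by rwa [← dist_eq_norm]
    have := h1 (x - x₀) (hx'.trans hh)
    rw [add_sub_cancel] at this
    exact this.trans (mul_le_mul_of_nonneg_left (pow_le_pow_left₀ (norm_nonneg _) hx' 2) K.2)
  have := (convex_closedBall x₀ ‖h‖).norm_image_sub_le_of_norm_hasFDerivWithin_le hd hb
    (Metric.mem_closedBall_self (norm_nonneg h)) (y := x₀ + h) (by simp)
  simp only [map_add, add_sub_cancel_left, sub_self, map_zero, Real.norm_eq_abs] at this
  refine le_trans (le_of_eq ?_) (this.trans (le_of_eq (by ring)))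
  congr 1
  simp
  ring

theorem norm_sq_unitVec_combination (φ a b : ℝ) :
    ‖a • unitVec φ + b • unitNormal φ‖ ^ 2 = a ^ 2 + b ^ 2 := by
  rw [EuclideanSpace.norm_sq_eq]
  simp [unitVec, unitNormal]
  linear_combination (a ^ 2 + b ^ 2) * Real.sin_sq_add_cos_sq φ

theorem unitNormal_add (φ α : ℝ) :
    unitNormal (φ + α) = (-Real.sin α) • unitVec φ + Real.cos α • unitNormal φ := by
  ext i
  fin_cases i <;> simp [unitVec, unitNormal, Real.sin_add, Real.cos_add] <;> ring

theorem unitVec_add (φ α : ℝ) :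
    unitVec (φ + α) = Real.cos α • unitVec φ + Real.sin α • unitNormal φ := by
  ext i
  fin_cases i <;> simp [unitVec, unitNormal, Real.sin_add, Real.cos_add] <;> ring

theorem inner_unitVec_self (φ : ℝ) : inner ℝ (unitVec φ) (unitVec φ) = 1 := by
  rw [real_inner_self_eq_norm_sq]
  simpa using norm_sq_unitVec_combination φ 1 0

theorem inner_unitVec_unitNormal (φ : ℝ) : inner ℝ (unitVec φ) (unitNormal φ) = 0 := by
  simp [unitVec, unitNormal, PiLp.inner_apply]
  ring

theorem fderiv_apply_eq_inner_gradient {f : Plane → ℝ} (x v : Plane) :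
    fderiv ℝ f x v = inner ℝ (gradient f x) v := by
  simp [gradient]

/-- A basis that is orthonormal for the metric of the graph of `f` and whose second vector is
tangent to the level line of `u`. -/
theorem exists_frame {f u : Plane → ℝ} {x₀ : Plane} {φ α : ℝ}
    (hsymm : ∀ v w, fderiv ℝ (fderiv ℝ f) x₀ v w = fderiv ℝ (fderiv ℝ f) x₀ w v)
    (hf : gradient f x₀ = ‖gradient f x₀‖ • unitVec φ) (hu0 : gradient u x₀ ≠ 0)
    (hu : gradient u x₀ = ‖gradient u x₀‖ • unitVec (φ + α)) :
    ∃ (e₁ e₂ : Plane) (A : ℝ), 0 < A ∧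
      (∀ y₁ y₂ : ℝ, ‖y₁ • e₁ + y₂ • e₂‖ ^ 2 + fderiv ℝ f x₀ (y₁ • e₁ + y₂ • e₂) ^ 2
        = y₁ ^ 2 + y₂ ^ 2) ∧
      fderiv ℝ u x₀ e₁ = A ∧ fderiv ℝ u x₀ e₂ = 0 ∧
      l2Rhs f u φ α x₀ = secondDeriv u x₀ e₂ e₂
        - A * (2 * fderiv ℝ f x₀ e₁ * secondDeriv f x₀ e₁ e₁
          + fderiv ℝ f x₀ e₁ * secondDeriv f x₀ e₂ e₂
          + 2 * fderiv ℝ f x₀ e₂ * secondDeriv f x₀ e₁ e₂) := by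
  have hfχ : fderiv ℝ f x₀ (unitVec φ) = ‖gradient f x₀‖ := by
    rw [fderiv_apply_eq_inner_gradient, hf, inner_smul_left, inner_unitVec_self]
    simp [← hf]
  have hfζ : fderiv ℝ f x₀ (unitNormal φ) = 0 := by
    rw [fderiv_apply_eq_inner_gradient, hf, inner_smul_left, inner_unitVec_unitNormal, mul_zero]
  have hg : 0 < ‖gradient u x₀‖ := norm_pos_iff.2 hu0
  have huχ : fderiv ℝ u x₀ (unitVec φ) = ‖gradient u x₀‖ * Real.cos α := by
    rw [fderiv_apply_eq_inner_gradient]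
    nth_rw 1 [hu]
    rw [inner_smul_left, unitVec_add, inner_add_left, inner_smul_left, inner_smul_left,
      inner_unitVec_self, real_inner_comm, inner_unitVec_unitNormal]
    simp
  have huζ : fderiv ℝ u x₀ (unitNormal φ) = ‖gradient u x₀‖ * Real.sin α := by
    have hn : inner ℝ (unitNormal φ) (unitNormal φ) = 1 := by
      rw [real_inner_self_eq_norm_sq]
      simpa using norm_sq_unitVec_combination φ 0 1
    rw [fderiv_apply_eq_inner_gradient]
    nth_rw 1 [hu]
    rw [inner_smul_left, unitVec_add, inner_add_left, inner_smul_left, inner_smul_left,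
      inner_unitVec_unitNormal, hn]
    simp
  have hFs := hsymm (unitVec φ) (unitNormal φ)
  have hnorm := norm_sq_unitVec_combination φ
  simp only [l2Rhs, unitNormal_add]
  unfold secondDeriv
  set s := ‖gradient f x₀‖
  set g := ‖gradient u x₀‖
  set χ := unitVec φ
  set ζ := unitNormal φ
  set D := 1 + s ^ 2 * Real.sin α ^ 2 with hD
  have hDpos : 0 < D := by positivity
  set w := √D with hw
  have hwpos : 0 < w := Real.sqrt_pos.2 hDpos
  have hw2 : w ^ 2 = D := Real.sq_sqrt hDpos.le
  set m := √(1 + s ^ 2) with hm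
  have hmpos : 0 < m := Real.sqrt_pos.2 (by positivity)
  have hm2 : m ^ 2 = 1 + s ^ 2 := Real.sq_sqrt (by positivity)
  have hcs := Real.sin_sq_add_cos_sq α
  set S := Real.sin α
  set c := Real.cos α
  have hc2 : c ^ 2 = 1 - S ^ 2 := by linarith
  have hW : w ^ 2 = c ^ 2 + m ^ 2 * S ^ 2 := by rw [hw2, hD, hm2, hc2]; ring
  have hs2 : s ^ 2 = m ^ 2 - 1 := by linarith
  rw [← hw2, ← hm2]
  clear_value w m s g χ ζ S c
  -- `w` and `m` are the lengths of `ξ` and `χ` in the graph metric. The second vector is `ξ / w`;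
  -- the first is the gradient of `u` with respect to the graph metric, normalised, and `g * w / m`
  -- is the length of that gradient.
  refine ⟨(c / (m * w)) • χ + (m * S / w) • ζ, (-S / w) • χ + (c / w) • ζ, g * w / m,
    by positivity, ?_, ?_, ?_, ?_⟩
  · intro y₁ y₂
    have hv : y₁ • ((c / (m * w)) • χ + (m * S / w) • ζ) + y₂ • ((-S / w) • χ + (c / w) • ζ)
        = (y₁ * (c / (m * w)) + y₂ * (-S / w)) • χ + (y₁ * (m * S / w) + y₂ * (c / w)) • ζ := by
      module
    rw [hv, hnorm]
    simp only [map_add, map_smul, hfχ, hfζ, smul_eq_mul]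
    rw [mul_zero, add_zero, mul_pow, hs2]
    field_simp
    linear_combination (-m ^ 2 * (y₁ ^ 2 + y₂ ^ 2)) * hW
  · simp only [map_add, map_smul, huχ, huζ, smul_eq_mul]
    field_simp
    exact hW.symm
  · simp only [map_add, map_smul, huχ, huζ, smul_eq_mul]
    ring
  · simp only [map_add, map_smul, hfχ, hfζ, smul_eq_mul, add_apply,
      smul_apply]
    set Fχχ := fderiv ℝ (fderiv ℝ f) x₀ χ χ
    set Fχζ := fderiv ℝ (fderiv ℝ f) x₀ χ ζ
    set Fζχ := fderiv ℝ (fderiv ℝ f) x₀ ζ χ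
    set Fζζ := fderiv ℝ (fderiv ℝ f) x₀ ζ ζ
    set Uχχ := fderiv ℝ (fderiv ℝ u) x₀ χ χ
    set Uχζ := fderiv ℝ (fderiv ℝ u) x₀ χ ζ
    set Uζχ := fderiv ℝ (fderiv ℝ u) x₀ ζ χ
    set Uζζ := fderiv ℝ (fderiv ℝ u) x₀ ζ ζ
    rw [hFs]
    clear_value Fχχ Fζχ Fζζ Uχχ Uχζ Uζχ Uζζ
    field_simp
    ring_nf
    linear_combination c * g * s * Fχχ * (3 * S ^ 2 * hm2 + 2 * hc2)

/-! ### Medians with respect to area -/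

/-- Every finite measure on the line has a median. -/
theorem exists_median_measure (m : Measure ℝ) [IsFiniteMeasure m] :
    ∃ μ : ℝ, m Set.univ / 2 ≤ m (Set.Ici μ) ∧ m Set.univ / 2 ≤ m (Set.Iic μ) := by
  rcases eq_or_ne (m Set.univ) 0 with h0 | h0
  · exact ⟨0, by simp [h0], by simp [h0]⟩
  have hfin : m Set.univ ≠ ⊤ := measure_ne_top m _
  have hhalf : m Set.univ / 2 < m Set.univ := ENNReal.half_lt_self h0 hfin
  have hhalf0 : 0 < m Set.univ / 2 := ENNReal.half_pos h0
  set s := {t : ℝ | m Set.univ / 2 ≤ m (Set.Iic t)} with hs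
  have htop : Filter.Tendsto (fun n : ℕ => m (Set.Iic (n : ℝ))) Filter.atTop
      (nhds (m Set.univ)) := by
    have := tendsto_measure_iUnion_atTop (μ := m) (s := fun n : ℕ => Set.Iic (n : ℝ))
      (fun a b h => Set.Iic_subset_Iic.2 (by exact_mod_cast h))
    have he : ⋃ n : ℕ, Set.Iic (n : ℝ) = Set.univ := by
      ext x
      simpa using exists_nat_ge x
    rwa [he] at this
  have hbot : Filter.Tendsto (fun n : ℕ => m (Set.Iic (-(n : ℝ)))) Filter.atTop (nhds 0) := by
    have := tendsto_measure_iInter_atTop (μ := m) (s := fun n : ℕ => Set.Iic (-(n : ℝ)))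
      (fun n => measurableSet_Iic.nullMeasurableSet)
      (fun a b h => Set.Iic_subset_Iic.2 (by simpa using h)) ⟨0, measure_ne_top m _⟩
    have he : ⋂ n : ℕ, Set.Iic (-(n : ℝ)) = ∅ := by
      ext x
      simp only [Set.mem_iInter, Set.mem_Iic, Set.mem_empty_iff_false, iff_false, not_forall,
        not_le]
      obtain ⟨n, hn⟩ := exists_nat_gt (-x)
      exact ⟨n, by linarith⟩
    rwa [he, measure_empty] at this
  have hne : s.Nonempty := by
    obtain ⟨n, hn⟩ := (htop.eventually_const_lt hhalf).exists
    exact ⟨n, hn.le⟩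
  have hbdd : BddBelow s := by
    obtain ⟨n, hn⟩ := (hbot.eventually_lt_const hhalf0).exists
    refine ⟨-n, fun t ht => ?_⟩
    by_contra! hlt
    exact absurd (ht.trans (measure_mono (Set.Iic_subset_Iic.2 hlt.le))) (not_le.2 hn)
  -- The lower half-median: continuity from below bounds the mass of the open left ray by one half,
  -- and continuity from above shows that the closed ray attains it.
  refine ⟨sInf s, ?_, ?_⟩
  · have hlt : m (Set.Iio (sInf s)) ≤ m Set.univ / 2 := by
      have hU : ⋃ n : ℕ, Set.Iic (sInf s - 1 / ((n : ℝ) + 1)) = Set.Iio (sInf s) := by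
        ext x
        simp only [Set.mem_iUnion, Set.mem_Iic, Set.mem_Iio]
        constructor
        · rintro ⟨n, hn⟩
          have : 0 < 1 / ((n : ℝ) + 1) := by positivity
          linarith
        · intro hx
          obtain ⟨n, hn⟩ := exists_nat_one_div_lt (sub_pos.2 hx)
          exact ⟨n, by linarith⟩
      have hmono : Monotone fun n : ℕ => Set.Iic (sInf s - 1 / ((n : ℝ) + 1)) := by
        intro a b hab
        refine Set.Iic_subset_Iic.2 (sub_le_sub_left ?_ _)
        exact Nat.one_div_le_one_div hab
      rw [← hU, hmono.measure_iUnion]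
      refine iSup_le fun n => ?_
      by_contra! hgt
      have h1 := csInf_le hbdd (show sInf s - 1 / ((n : ℝ) + 1) ∈ s from hgt.le)
      have : 0 < 1 / ((n : ℝ) + 1) := by positivity
      linarith
    have hsplit := measure_add_measure_compl (μ := m) (measurableSet_Iio (a := sInf s))
    rw [Set.compl_Iio] at hsplit
    by_contra! hgt
    have := ENNReal.add_lt_add_of_le_of_lt (ne_top_of_le_ne_top hfin
      (measure_mono (Set.subset_univ _))) hlt hgt
    rw [hsplit, ENNReal.add_halves] at this
    exact lt_irrefl _ this
  · have hI : ⋂ n : ℕ, Set.Iic (sInf s + 1 / ((n : ℝ) + 1)) = Set.Iic (sInf s) := by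
      ext x
      simp only [Set.mem_iInter, Set.mem_Iic]
      constructor
      · intro h
        by_contra! hx
        obtain ⟨n, hn⟩ := exists_nat_one_div_lt (sub_pos.2 hx)
        linarith [h n]
      · intro h n
        have : 0 < 1 / ((n : ℝ) + 1) := by positivity
        linarith
    have := tendsto_measure_iInter_atTop (μ := m)
      (s := fun n : ℕ => Set.Iic (sInf s + 1 / ((n : ℝ) + 1)))
      (fun n => measurableSet_Iic.nullMeasurableSet)
      (fun a b hab => Set.Iic_subset_Iic.2
        (add_le_add_right (Nat.one_div_le_one_div hab) _)) ⟨0, measure_ne_top m _⟩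
    rw [hI] at this
    refine ge_of_tendsto' this fun n => ?_
    have hpos : 0 < 1 / ((n : ℝ) + 1) := by positivity
    obtain ⟨t, ht, htlt⟩ := exists_lt_of_csInf_lt hne (lt_add_of_pos_right (sInf s) hpos)
    exact le_trans ht (measure_mono (Set.Iic_subset_Iic.2 htlt.le))

theorem measurableSet_inter_le {B : Set Plane} {u : Plane → ℝ} (hB : IsClosed B)
    (hu : ContinuousOn u B) (m : ℝ) : MeasurableSet {x | x ∈ B ∧ m ≤ u x} :=
  (hu.preimage_isClosed_of_isClosed hB isClosed_Ici).measurableSet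

/-- Apply the result on the line to the image of the restricted measure. Extending `u` by zero
outside `B` makes it measurable, so `A` itself need not be. -/
theorem exists_isMedian {A B : Set Plane} {u : Plane → ℝ} (hB : IsClosed B)
    (hu : ContinuousOn u B) (hAB : A ⊆ B) (hA : volume A ≠ ⊤) : ∃ μ, IsMedian u A μ := by
  classical
  set v := B.piecewise u (fun _ => (0 : ℝ)) with hv
  have hvm : Measurable v := hu.measurable_piecewise continuousOn_const hB.measurableSet
  have hvu : ∀ x ∈ A, v x = u x := fun x hx => Set.piecewise_eq_of_mem _ _ _ (hAB hx)
  have : IsFiniteMeasure (volume.restrict A) := ⟨by simpa using hA.lt_top⟩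
  obtain ⟨μ, h1, h2⟩ := exists_median_measure ((volume.restrict A).map v)
  rw [Measure.map_apply hvm MeasurableSet.univ, Set.preimage_univ, Measure.restrict_apply_univ,
    Measure.map_apply hvm (by measurability), Measure.restrict_apply (hvm (by measurability))]
    at h1 h2
  refine ⟨μ, h1.trans (measure_mono ?_), h2.trans (measure_mono ?_)⟩
  · rintro x ⟨hx1, hx2⟩
    exact ⟨hx2, by rw [← hvu x hx2]; exact hx1⟩
  · rintro x ⟨hx1, hx2⟩
    exact ⟨hx2, by rw [← hvu x hx2]; exact hx1⟩

/-- Sublevel sets of a continuous function split the area of any set, measurable or not. -/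
theorem volume_split {A B : Set Plane} {u : Plane → ℝ} (hB : IsClosed B)
    (hu : ContinuousOn u B) (hAB : A ⊆ B) (m : ℝ) :
    volume {x | x ∈ A ∧ m ≤ u x} + volume {x | x ∈ A ∧ u x < m} = volume A := by
  rw [← measure_inter_add_sdiff A (measurableSet_inter_le hB hu m)]
  congr 2
  · ext x
    exact ⟨fun h => ⟨h.1, hAB h.1, h.2⟩, fun h => ⟨h.1, h.2.2⟩⟩
  · ext x
    exact ⟨fun h => ⟨h.1, fun h' => absurd h'.2 (not_le.2 h.2)⟩,
      fun h => ⟨h.1, not_le.1 fun h' => h.2 ⟨hAB h.1, h'⟩⟩⟩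

/-- If `μ ≥ m`, the part above `m` would contain at least half of the area and the part below
strictly more. The alternative of a null superlevel set reduces to the strict inequality because `A`
has positive area. -/
theorem IsMedian.lt_of_volume_lt {A B : Set Plane} {u : Plane → ℝ} {μ m : ℝ} (hB : IsClosed B)
    (hu : ContinuousOn u B) (hAB : A ⊆ B) (hA : volume A ≠ ⊤)
    (hA0 : volume A ≠ 0)
    (hlt : volume {x | x ∈ A ∧ m ≤ u x} < volume {x | x ∈ A ∧ u x < m} ∨
      volume {x | x ∈ A ∧ m ≤ u x} = 0)
    (hμ : IsMedian u A μ) : μ < m := by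
  by_contra! hle
  have hlt : volume {x | x ∈ A ∧ m ≤ u x} < volume {x | x ∈ A ∧ u x < m} := by
    refine hlt.elim id fun h => ?_
    have hs := volume_split hB hu hAB m
    rw [h, zero_add] at hs
    rw [h, hs]
    exact pos_iff_ne_zero.2 hA0
  have h1 : volume A / 2 ≤ volume {x | x ∈ A ∧ m ≤ u x} :=
    hμ.1.trans (measure_mono fun x hx => ⟨hx.1, hle.trans hx.2⟩)
  have h2 := ENNReal.add_lt_add_of_le_of_lt (ne_top_of_le_ne_top hA
    (ENNReal.half_le_self)) h1 (h1.trans_lt hlt)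
  rw [volume_split hB hu hAB, ENNReal.add_halves] at h2
  exact lt_irrefl _ h2

theorem IsMedian.neg {A : Set Plane} {u : Plane → ℝ} {μ : ℝ} (h : IsMedian u A μ) :
    IsMedian (fun x => -u x) A (-μ) := by
  unfold IsMedian at h ⊢
  simp only [neg_le_neg_iff]
  exact ⟨h.2, h.1⟩

/-- Two medians coincide if every open interval between them is attained on a part of positive
area. -/
theorem IsMedian.le_of_volume_pos {A B : Set Plane} {u : Plane → ℝ} {μ₁ μ₂ : ℝ} (hB : IsClosed B)
    (hu : ContinuousOn u B) (hAB : A ⊆ B) (hA : volume A ≠ ⊤)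
    (h₁ : IsMedian u A μ₁) (h₂ : IsMedian u A μ₂)
    (hpos : μ₁ < μ₂ → volume {x | x ∈ A ∧ μ₁ < u x ∧ u x < μ₂} ≠ 0) : μ₂ ≤ μ₁ := by
  by_contra! hlt
  have s2 := volume_split hB hu hAB μ₂
  have s1 := volume_split (A := {x | x ∈ A ∧ u x < μ₂}) (u := fun x => -u x) hB hu.neg
    (fun x hx => hAB hx.1) (-μ₁)
  have e1 : {x | x ∈ {x | x ∈ A ∧ u x < μ₂} ∧ -μ₁ ≤ -u x} = {x | x ∈ A ∧ u x ≤ μ₁} := by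
    ext x
    simp only [Set.mem_ofPred_eq, neg_le_neg_iff]
    exact ⟨fun h => ⟨h.1.1, h.2⟩, fun h => ⟨⟨h.1, h.2.trans_lt hlt⟩, h.2⟩⟩
  have e2 : {x | x ∈ {x | x ∈ A ∧ u x < μ₂} ∧ -u x < -μ₁} = {x | x ∈ A ∧ μ₁ < u x ∧ u x < μ₂} := by
    ext x
    simp only [Set.mem_ofPred_eq, neg_lt_neg_iff]
    tauto
  rw [e1, e2] at s1
  rw [← s1] at s2
  have h3 := add_le_add h₂.1 h₁.2
  rw [ENNReal.add_halves] at h3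
  have hne : volume {x | x ∈ A ∧ μ₂ ≤ u x} + volume {x | x ∈ A ∧ u x ≤ μ₁} ≠ ⊤ := by
    refine ENNReal.add_ne_top.2 ⟨?_, ?_⟩ <;>
    exact ne_top_of_le_ne_top hA (measure_mono fun x hx => hx.1)
  rw [← s2, ← add_assoc] at h3
  exact absurd h3 (not_le.2 (ENNReal.lt_add_right hne (hpos hlt)))

/-! ### Rescaling around the centre and comparison of areas -/

/-- An affine isomorphism scales areas by a constant. -/
theorem exists_volume_image_affine (L : (ℝ × ℝ) ≃L[ℝ] Plane) (x₀ : Plane) :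
    ∃ c : ENNReal, c ≠ 0 ∧ c ≠ ⊤ ∧
      ∀ Y : Set (ℝ × ℝ), volume ((fun y => x₀ + L y) '' Y) = c * volume Y := by
  set ν : Measure (ℝ × ℝ) := (volume : Measure Plane).map L.symm with hν
  have : ν.IsAddHaarMeasure := L.symm.isAddHaarMeasure_map volume
  refine ⟨Measure.addHaarScalarFactor ν volume, ?_, ENNReal.coe_ne_top, fun Y => ?_⟩
  · have := Measure.addHaarScalarFactor_pos_of_isAddHaarMeasure ν (volume : Measure (ℝ × ℝ))
    exact_mod_cast this.ne'
  · have h1 : ν Y = Measure.addHaarScalarFactor ν volume * volume Y := by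
      conv_lhs => rw [Measure.isAddLeftInvariant_eq_smul ν (volume : Measure (ℝ × ℝ))]
      rfl
    rw [← h1, hν]
    have h2 : (fun y => x₀ + L y) '' Y = (fun x => x₀ + x) '' (L '' Y) := by
      rw [Set.image_image]
    rw [h2, Set.image_add_left, measure_preimage_add]
    have h3 := (L.symm.toHomeomorph.measurableEmbedding).map_apply (volume : Measure Plane) Y
    rw [ContinuousLinearEquiv.coe_toHomeomorph] at h3
    rw [h3, L.image_eq_preimage_symm]

/-- Along a segment the directional derivative of `f` differs from the increment of `f` by
`O(‖h‖²)`, by the Taylor bounds at `x₀`. The square of this deviation is the fourth-order excess. -/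
theorem exists_mem_amoeba_of_chord_le {Ω : Set Plane} {f : Plane → ℝ} {x₀ : Plane}
    (hx₀ : x₀ ∈ interior Ω) (hf : ContDiffOn ℝ ∞ f Ω) :
    ∃ K r : ℝ, 0 ≤ K ∧ 0 < r ∧ ∀ ρ : ℝ, 0 < ρ → ∀ h : Plane, h ≠ 0 → ‖h‖ ≤ r →
      ‖h‖ ^ 2 + (f (x₀ + h) - f x₀) ^ 2 + K * ‖h‖ ^ 4 ≤ ρ ^ 2 → x₀ + h ∈ amoeba nuL2 Ω f ρ x₀ := by
  have hfa : ContDiffAt ℝ 3 f x₀ :=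
    (hf.contDiffAt (mem_interior_iff_mem_nhds.1 hx₀)).of_le (WithTop.coe_le_coe.2 le_top)
  obtain ⟨C, r, hC, hr, hT⟩ := exists_taylor_bounds hfa
  obtain ⟨r', hr', hball⟩ := Metric.isOpen_iff.1 isOpen_interior x₀ hx₀
  set G := ‖fderiv ℝ (fderiv ℝ f) x₀‖ with hG
  refine ⟨(2 * C + 2 * G) ^ 2, min (min r (r' / 2)) 1, by positivity, by positivity, ?_⟩
  intro ρ hρ h hh0 hh hle
  have hhr : ‖h‖ ≤ r := hh.trans ((min_le_left _ _).trans (min_le_left _ _))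
  have hhr' : ‖h‖ ≤ r' / 2 := hh.trans ((min_le_left _ _).trans (min_le_right _ _))
  have hh1 : ‖h‖ ≤ 1 := hh.trans (min_le_right _ _)
  have hnorm : ∀ t ∈ Set.Icc (0 : ℝ) 1, ‖t • h‖ ≤ ‖h‖ := fun t ht => by
    rw [norm_smul, Real.norm_of_nonneg ht.1]
    exact mul_le_of_le_one_left (norm_nonneg _) ht.2
  refine add_mem_amoeba_nuL2 (K := 2 * C + 2 * G) isOpen_interior interior_subset
    ((hf.of_le (by simp)).mono interior_subset) hh0 hρ ?_ ?_ hle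
  · intro t ht
    refine hball ?_
    rw [Metric.mem_ball, dist_eq_norm, add_sub_cancel_left]
    linarith [hnorm t ht]
  · intro t ht
    obtain ⟨h1, -⟩ := hT (t • h) ((hnorm t ht).trans hhr)
    obtain ⟨-, h2⟩ := hT h hhr
    have h3 := (ContinuousLinearMap.le_of_opNorm_le _ h1 h)
    have hq : ∀ v : Plane, ‖v‖ ≤ ‖h‖ → |fderiv ℝ (fderiv ℝ f) x₀ v h| ≤ G * ‖h‖ ^ 2 := by
      intro v hv
      have := (fderiv ℝ (fderiv ℝ f) x₀).le_opNorm₂ v h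
      rw [Real.norm_eq_abs] at this
      refine this.trans ?_
      rw [mul_assoc, sq]
      gcongr
    have h4 := hq (t • h) (hnorm t ht)
    have h5 := hq h le_rfl
    have h6 : C * ‖t • h‖ ^ 2 * ‖h‖ ≤ C * ‖h‖ ^ 2 := by
      have a := pow_le_pow_left₀ (norm_nonneg _) (hnorm t ht) 2
      calc C * ‖t • h‖ ^ 2 * ‖h‖ ≤ C * ‖h‖ ^ 2 * 1 := by gcongr
        _ = _ := mul_one _
    have h7 : C * ‖h‖ ^ 3 ≤ C * ‖h‖ ^ 2 :=
      mul_le_mul_of_nonneg_left (pow_le_pow_of_le_one (norm_nonneg _) hh1 (by norm_num)) hC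
    simp only [sub_apply, Real.norm_eq_abs] at h3
    have a2 := abs_le.1 h2
    have a3 := abs_le.1 (h3.trans h6)
    have a4 := abs_le.1 h4
    have a5 := abs_le.1 h5
    have hG0 : 0 ≤ G * ‖h‖ ^ 2 := by positivity
    rw [abs_le]
    constructor <;> linarith [a2.1, a2.2, a3.1, a3.2, a4.1, a4.2, a5.1, a5.2]

/-- Squares the expansion `d = p + ρ q / 2 + O(ρ²)` of the difference quotient of `f`; the cross
term `ρ p q` becomes the cubic form. -/
theorem abs_sq_sub_le {C Φ ρ d p q : ℝ} (hρ : 0 < ρ) (hρ1 : ρ ≤ 1)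
    (hd : |d - p - ρ * q / 2| ≤ C * ρ ^ 2) (hp : |p| ≤ 3) (hq : |q| ≤ Φ) :
    |d ^ 2 - (p ^ 2 + ρ * (p * q))| ≤ (Φ ^ 2 + 6 * C + C * Φ + C ^ 2) * ρ ^ 2 := by
  set e := d - p - ρ * q / 2 with he
  have hΦ : 0 ≤ Φ := (abs_nonneg q).trans hq
  have h1 : d ^ 2 - (p ^ 2 + ρ * (p * q)) = ρ ^ 2 * (q ^ 2 / 4) + 2 * p * e + ρ * q * e + e ^ 2 := by
    rw [he]; ring
  have hqq : q ^ 2 ≤ Φ ^ 2 := by rw [← sq_abs]; exact pow_le_pow_left₀ (abs_nonneg _) hq 2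
  have hee : e ^ 2 ≤ C ^ 2 * ρ ^ 2 := by
    have h2 : e ^ 2 ≤ (C * ρ ^ 2) ^ 2 := by
      rw [← sq_abs]; exact pow_le_pow_left₀ (abs_nonneg _) hd 2
    have h3 : C ^ 2 * (ρ ^ 2 * ρ ^ 2) ≤ C ^ 2 * (ρ ^ 2 * 1) := by
      gcongr
      exact pow_le_one₀ hρ.le hρ1
    linarith
  have hpe : |2 * p * e| ≤ 6 * (C * ρ ^ 2) := by
    rw [abs_mul, abs_mul, abs_two]
    have := mul_le_mul hp hd (abs_nonneg _) (by norm_num)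
    linarith
  have hqe : |ρ * q * e| ≤ Φ * (C * ρ ^ 2) := by
    rw [abs_mul]
    refine mul_le_mul ?_ hd (abs_nonneg _) hΦ
    rw [abs_mul, abs_of_pos hρ]
    exact (mul_le_of_le_one_left (abs_nonneg _) hρ1).trans hq
  have hq4 : ρ ^ 2 * (q ^ 2 / 4) ≤ ρ ^ 2 * Φ ^ 2 :=
    mul_le_mul_of_nonneg_left (by linarith [sq_nonneg q]) (sq_nonneg ρ)
  have hq5 : 0 ≤ ρ ^ 2 * (q ^ 2 / 4) := by positivity
  have he0 := sq_nonneg e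
  have hΦρ : 0 ≤ ρ ^ 2 * Φ ^ 2 := by positivity
  have hCρ : 0 ≤ C ^ 2 * ρ ^ 2 := by positivity
  have a1 := abs_le.1 hpe
  have a2 := abs_le.1 hqe
  rw [h1, abs_le]
  constructor <;> linarith [a1.1, a1.2, a2.1, a2.2]

/-- A linear chart in which the chord length from `x₀` and the increment of `u` have normal forms
up to second order. -/
theorem exists_chart {f u : Plane → ℝ} {x₀ : Plane} {φ α : ℝ}
    (hfa : ContDiffAt ℝ 3 f x₀) (hua : ContDiffAt ℝ 3 u x₀)
    (hfφ : gradient f x₀ = ‖gradient f x₀‖ • unitVec φ) (hu0 : gradient u x₀ ≠ 0)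
    (huφ : gradient u x₀ = ‖gradient u x₀‖ • unitVec (φ + α)) :
    ∃ (P : Coeffs) (l : (ℝ × ℝ) →ₗ[ℝ] Plane), 0 < P.A ∧ P.shift = l2Rhs f u φ α x₀ / 6 ∧
      (∀ y, ‖l y‖ ^ 2 + fderiv ℝ f x₀ (l y) ^ 2 = y.1 ^ 2 + y.2 ^ 2) ∧
      (∀ y, fderiv ℝ u x₀ (l y) = P.A * y.1) ∧
      (∀ y, fderiv ℝ (fderiv ℝ u) x₀ (l y) (l y) / 2 = P.quad y.1 y.2) ∧
      (∀ y, fderiv ℝ f x₀ (l y) * fderiv ℝ (fderiv ℝ f) x₀ (l y) (l y) = P.cubic y.1 y.2) := by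
  have hsymm : IsSymmSndFDerivAt ℝ f x₀ := hfa.isSymmSndFDerivAt (by simp; norm_cast)
  have hsymmu : IsSymmSndFDerivAt ℝ u x₀ := hua.isSymmSndFDerivAt (by simp; norm_cast)
  obtain ⟨e₁, e₂, A, hA, hG, hue₁, hue₂, hR⟩ := exists_frame hsymm hfφ hu0 huφ
  have hH12 := hsymmu e₂ e₁
  have hF12 := hsymm e₂ e₁
  unfold secondDeriv at hR
  set p := fderiv ℝ f x₀
  set F := fderiv ℝ (fderiv ℝ f) x₀
  set a := fderiv ℝ u x₀
  set H := fderiv ℝ (fderiv ℝ u) x₀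
  -- The quadratic form is half the Hessian of `u`; the cubic form is the derivative of `f` times
  -- its Hessian, both expanded in the frame.
  refine ⟨⟨A, H e₁ e₁ / 2, H e₁ e₂, H e₂ e₂ / 2, p e₁ * F e₁ e₁,
    2 * p e₁ * F e₁ e₂ + p e₂ * F e₁ e₁, p e₁ * F e₂ e₂ + 2 * p e₂ * F e₁ e₂, p e₂ * F e₂ e₂⟩,
    (LinearMap.fst ℝ ℝ ℝ).smulRight e₁ + (LinearMap.snd ℝ ℝ ℝ).smulRight e₂, hA, ?_, ?_, ?_, ?_, ?_⟩
  · rw [hR]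
    simp only [Coeffs.shift]
    ring
  · exact fun y => hG y.1 y.2
  · intro y
    simp only [LinearMap.add_apply, LinearMap.smulRight_apply, LinearMap.fst_apply,
      LinearMap.snd_apply, map_add, map_smul, hue₁, hue₂, smul_eq_mul]
    ring
  · intro y
    simp only [LinearMap.add_apply, LinearMap.smulRight_apply, LinearMap.fst_apply,
      LinearMap.snd_apply, map_add, map_smul, add_apply, smul_apply, smul_eq_mul, hH12,
      Coeffs.quad]
    ring
  · intro y
    simp only [LinearMap.add_apply, LinearMap.smulRight_apply, LinearMap.fst_apply,
      LinearMap.snd_apply, map_add, map_smul, add_apply, smul_apply, smul_eq_mul, hF12,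
      Coeffs.cubic]
    ring

theorem abs_div_sub_le_of_taylor {g : Plane → ℝ} {C ρ : ℝ} {x₀ v : Plane} (hρ : 0 < ρ)
    (h : |g (x₀ + ρ • v) - g x₀ - fderiv ℝ g x₀ (ρ • v)
      - fderiv ℝ (fderiv ℝ g) x₀ (ρ • v) (ρ • v) / 2| ≤ C * ‖ρ • v‖ ^ 3) :
    |(g (x₀ + ρ • v) - g x₀) / ρ - fderiv ℝ g x₀ v - ρ * fderiv ℝ (fderiv ℝ g) x₀ v v / 2|
      ≤ C * ‖v‖ ^ 3 * ρ ^ 2 := by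
  rw [norm_smul, Real.norm_of_nonneg hρ.le] at h
  simp only [map_smul, smul_apply, smul_eq_mul] at h
  have h2 : (g (x₀ + ρ • v) - g x₀) / ρ - fderiv ℝ g x₀ v
      - ρ * fderiv ℝ (fderiv ℝ g) x₀ v v / 2 = (g (x₀ + ρ • v) - g x₀
      - ρ * fderiv ℝ g x₀ v - ρ * (ρ * fderiv ℝ (fderiv ℝ g) x₀ v v) / 2) / ρ := by
    field_simp
  rw [h2, abs_div, abs_of_pos hρ, div_le_iff₀ hρ]
  exact h.trans (le_of_eq (by ring))

/-- Uniform second-order normal forms of the rescaled chord length and increment. -/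
theorem exists_scaled_bounds {f u : Plane → ℝ} {x₀ : Plane} {P : Coeffs}
    {l : (ℝ × ℝ) →ₗ[ℝ] Plane} (hfa : ContDiffAt ℝ 3 f x₀) (hua : ContDiffAt ℝ 3 u x₀)
    (hG : ∀ y, ‖l y‖ ^ 2 + fderiv ℝ f x₀ (l y) ^ 2 = y.1 ^ 2 + y.2 ^ 2)
    (hal : ∀ y, fderiv ℝ u x₀ (l y) = P.A * y.1)
    (hHl : ∀ y, fderiv ℝ (fderiv ℝ u) x₀ (l y) (l y) / 2 = P.quad y.1 y.2)
    (hFl : ∀ y, fderiv ℝ f x₀ (l y) * fderiv ℝ (fderiv ℝ f) x₀ (l y) (l y) = P.cubic y.1 y.2) :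
    ∃ C₀ r : ℝ, 0 ≤ C₀ ∧ 0 < r ∧ ∀ ρ, 0 < ρ → ρ < r →
      (∀ y, ‖y‖ ≤ 2 → ‖l y‖ ≤ 3 ∧
        |(u (x₀ + ρ • l y) - u x₀) / ρ - (P.A * y.1 + ρ * P.quad y.1 y.2)| ≤ C₀ * ρ ^ 2 ∧
        |‖l y‖ ^ 2 + ((f (x₀ + ρ • l y) - f x₀) / ρ) ^ 2
          - (y.1 ^ 2 + y.2 ^ 2 + ρ * P.cubic y.1 y.2)| ≤ C₀ * ρ ^ 2) ∧
      ∀ y, ‖l y‖ ^ 2 + ((f (x₀ + ρ • l y) - f x₀) / ρ) ^ 2 ≤ 1 → ‖y‖ ≤ 2 := by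
  obtain ⟨Cf, rf, hCf, hrf, hTf⟩ := exists_taylor_bounds hfa
  obtain ⟨Cu, ru, hCu, hru, hTu⟩ := exists_taylor_bounds hua
  set p := fderiv ℝ f x₀
  set F := fderiv ℝ (fderiv ℝ f) x₀
  have hl3 : ∀ y, ‖y‖ ≤ 2 → ‖l y‖ ≤ 3 ∧ |p (l y)| ≤ 3 := by
    intro y hy
    have h1 := abs_le.1 ((norm_fst_le y).trans hy)
    have h2 := abs_le.1 ((norm_snd_le y).trans hy)
    have h3 := hG y
    have h4 : y.1 ^ 2 ≤ 4 := by nlinarith [h1.1, h1.2]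
    have h5 : y.2 ^ 2 ≤ 4 := by nlinarith [h2.1, h2.2]
    have h6 := sq_nonneg (p (l y))
    have h7 := sq_nonneg ‖l y‖
    exact ⟨(abs_le_of_sq_le_sq' (by linarith) (by norm_num)).2,
      abs_le_of_sq_le_sq (by linarith) (by norm_num)⟩
  have hF : ∀ v : Plane, |F v v| ≤ ‖F‖ * ‖v‖ ^ 2 := by
    intro v
    have h1 := F.le_opNorm₂ v v
    rw [Real.norm_eq_abs] at h1
    exact h1.trans (le_of_eq (by ring))
  have hFΦ : ∀ y, ‖y‖ ≤ 2 → |F (l y) (l y)| ≤ ‖F‖ * 9 := by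
    intro y hy
    refine (hF _).trans (mul_le_mul_of_nonneg_left ?_ (norm_nonneg F))
    have := pow_le_pow_left₀ (norm_nonneg _) (hl3 y hy).1 2
    linarith
  set D := (‖F‖ * 9) ^ 2 + 6 * (27 * Cf) + 27 * Cf * (‖F‖ * 9) + (27 * Cf) ^ 2 with hD
  have hD0 : 0 ≤ D := by positivity
  have hr : 0 < min (min 1 (1 / (2 * Cf + ‖F‖ + 1))) (min (rf / 3) (ru / 3)) :=
    lt_min (lt_min one_pos (by positivity)) (lt_min (by positivity) (by positivity))
  refine ⟨D + 27 * Cu, _, by positivity, hr, ?_⟩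
  intro ρ hρ hρlt
  simp only [lt_min_iff] at hρlt
  obtain ⟨⟨hρ1, hρF⟩, hρf, hρu⟩ := hρlt
  have hρl : ∀ y, ‖ρ • l y‖ = ρ * ‖l y‖ := fun y => by rw [norm_smul, Real.norm_of_nonneg hρ.le]
  have cube : ∀ {C : ℝ}, 0 ≤ C → ∀ y, ‖y‖ ≤ 2 → C * ‖l y‖ ^ 3 * ρ ^ 2 ≤ 27 * C * ρ ^ 2 := by
    intro C hC y hy
    have h1 := pow_le_pow_left₀ (norm_nonneg _) (hl3 y hy).1 3
    have h2 := mul_le_mul_of_nonneg_left h1 hC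
    exact mul_le_mul_of_nonneg_right (by linarith) (sq_nonneg ρ)
  have small : ∀ y {r : ℝ}, ρ < r / 3 → ‖l y‖ ≤ 3 → ‖ρ • l y‖ ≤ r := by
    intro y r hr hy
    rw [hρl]
    have := mul_le_mul_of_nonneg_left hy hρ.le
    linarith
  refine ⟨fun y hy => ⟨(hl3 y hy).1, ?_, ?_⟩, ?_⟩
  · have h1 := (abs_div_sub_le_of_taylor hρ (hTu _ (small y hρu (hl3 y hy).1)).2).trans
      (cube hCu y hy)
    rw [hal, mul_div_assoc, hHl, sub_sub] at h1
    exact h1.trans (mul_le_mul_of_nonneg_right (by linarith) (sq_nonneg ρ))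
  · have h1 := (abs_div_sub_le_of_taylor hρ (hTf _ (small y hρf (hl3 y hy).1)).2).trans
      (cube hCf y hy)
    have h2 := abs_sq_sub_le hρ hρ1.le h1 (hl3 y hy).2 (hFΦ y hy)
    rw [hFl] at h2
    rw [← hG]
    refine le_trans (le_of_eq ?_) (h2.trans
      (mul_le_mul_of_nonneg_right (by linarith) (sq_nonneg ρ)))
    congr 1
    ring
  · intro y hy
    set d := (f (x₀ + ρ • l y) - f x₀) / ρ with hd
    have hd2 := sq_nonneg d
    have hn2 := sq_nonneg ‖l y‖
    have hn : ‖l y‖ ≤ 1 := (abs_le_of_sq_le_sq' (by linarith) zero_le_one).2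
    have hd1 : |d| ≤ 1 := abs_le_of_sq_le_sq (by linarith) zero_le_one
    have h1 := abs_div_sub_le_of_taylor hρ (hTf _ (small y hρf (by linarith))).2
    have hFy : |F (l y) (l y)| ≤ ‖F‖ := (hF _).trans
      (mul_le_of_le_one_right (norm_nonneg F) (pow_le_one₀ (norm_nonneg _) hn))
    have h2 : Cf * ‖l y‖ ^ 3 * ρ ^ 2 ≤ Cf * ρ := by
      have a1 : Cf * ‖l y‖ ^ 3 ≤ Cf := mul_le_of_le_one_right hCf (pow_le_one₀ (norm_nonneg _) hn)
      have a2 : ρ ^ 2 ≤ ρ := by nlinarith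
      exact mul_le_mul a1 a2 (sq_nonneg ρ) hCf
    have h3 : |ρ * F (l y) (l y) / 2| ≤ ρ * ‖F‖ / 2 := by
      rw [abs_div, abs_mul, abs_of_pos hρ, abs_two]
      have := mul_le_mul_of_nonneg_left hFy hρ.le
      linarith
    rw [lt_div_iff₀ (by positivity)] at hρF
    have a1 := abs_le.1 (h1.trans h2)
    have a2 := abs_le.1 h3
    have a3 := abs_le.1 hd1
    -- The smallness of `ρ` limits the Taylor error to `1/2`. Hence `y.1² + y.2² ≤ 1 + 9/4 < 4`, and
    -- a point of the rescaled chord set lies in the box of radius 2.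
    have h4 : |p (l y)| ≤ 3 / 2 := by
      rw [abs_le]
      constructor <;> linarith [a1.1, a1.2, a2.1, a2.2, a3.1, a3.2]
    have h5 : p (l y) ^ 2 ≤ (3 / 2) ^ 2 := by
      rw [← sq_abs]
      exact pow_le_pow_left₀ (abs_nonneg _) h4 2
    have h6 := hG y
    have hy1 := sq_nonneg y.1
    have hy2 := sq_nonneg y.2
    rw [Prod.norm_def, sup_le_iff]
    exact ⟨abs_le_of_sq_le_sq (by linarith) zero_le_two,
      abs_le_of_sq_le_sq (by linarith) zero_le_two⟩

/-- The outer chord set covers the upper part of the amoeba, the reflected image lies in the inner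
chord set, and the affine chart scales both areas by the same constant. -/
theorem exists_volume_superlevel_lt {Ω : Set Plane} {f u : Plane → ℝ} {x₀ : Plane} {φ α : ℝ}
    (hf : ContDiffOn ℝ ∞ f Ω) (hu : ContDiffOn ℝ ∞ u Ω) (hx₀ : x₀ ∈ interior Ω)
    (hfφ : gradient f x₀ = ‖gradient f x₀‖ • unitVec φ) (hu0 : gradient u x₀ ≠ 0)
    (huφ : gradient u x₀ = ‖gradient u x₀‖ • unitVec (φ + α)) :
    ∃ C ρ₀ : ℝ, 0 < ρ₀ ∧ ∀ ρ : ℝ, 0 < ρ → ρ < ρ₀ → ∀ m : ℝ,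
      m = u x₀ + ρ ^ 2 / 6 * l2Rhs f u φ α x₀ + C * ρ ^ 3 →
      volume {x | x ∈ amoeba nuL2 Ω f ρ x₀ ∧ m ≤ u x}
        < volume {x | x ∈ amoeba nuL2 Ω f ρ x₀ ∧ u x < m} ∨
      volume {x | x ∈ amoeba nuL2 Ω f ρ x₀ ∧ m ≤ u x} = 0 := by
  have hfa : ContDiffAt ℝ 3 f x₀ :=
    (hf.contDiffAt (mem_interior_iff_mem_nhds.1 hx₀)).of_le (WithTop.coe_le_coe.2 le_top)
  have hua : ContDiffAt ℝ 3 u x₀ :=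
    (hu.contDiffAt (mem_interior_iff_mem_nhds.1 hx₀)).of_le (WithTop.coe_le_coe.2 le_top)
  obtain ⟨P, l, hA, hshift, hG, hal, hHl, hFl⟩ := exists_chart hfa hua hfφ hu0 huφ
  obtain ⟨C', r, hC', hr, hbounds⟩ := exists_scaled_bounds hfa hua hG hal hHl hFl
  obtain ⟨K, rK, hK, hrK, hmem⟩ := exists_mem_amoeba_of_chord_le hx₀ hf
  obtain ⟨r', hr', hball⟩ := Metric.isOpen_iff.1 isOpen_interior x₀ hx₀
  -- Adding `K` to the Taylor constant makes the reflected image satisfy `Q ≤ 1 - (C' + K) ρ²`,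
  -- which leaves room for the fourth-order excess of segments over chords.
  obtain ⟨C₁, κ, ε₀, hC₁, hκ, hε₀, hcore⟩ :=
    P.exists_area_increasing_reflection hA (add_nonneg hC' hK)
  have hρ₀ : 0 < min (min ε₀ r) (min (rK / 3) (r' / 4)) :=
    lt_min (lt_min hε₀ hr) (lt_min (by positivity) (by positivity))
  refine ⟨C₁, _, hρ₀, ?_⟩
  intro ρ hρ hρlt m hm
  simp only [lt_min_iff] at hρlt
  obtain ⟨⟨hρε, hρr⟩, hρK, hρr'⟩ := hρlt
  obtain ⟨hb, hbox⟩ := hbounds ρ hρ hρr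
  have hinj : Function.Injective (ρ • l) := by
    rw [← LinearMap.ker_eq_bot, LinearMap.ker_eq_bot']
    intro y hy
    have h0 : l y = 0 := by
      rw [LinearMap.smul_apply] at hy
      exact (smul_eq_zero.1 hy).resolve_left hρ.ne'
    have h1 := hG y
    rw [h0] at h1
    simp only [norm_zero, map_zero] at h1
    have hy1 := sq_nonneg y.1
    have hy2 := sq_nonneg y.2
    exact Prod.ext ((pow_eq_zero_iff two_ne_zero).1 (by linarith))
      ((pow_eq_zero_iff two_ne_zero).1 (by linarith))
  obtain ⟨L, hLy⟩ : ∃ L : (ℝ × ℝ) ≃L[ℝ] Plane, ∀ y, L y = ρ • l y :=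
    ⟨(LinearEquiv.ofInjectiveOfFinrankEq (ρ • l) hinj (by simp)).toContinuousLinearEquiv,
      fun _ => rfl⟩
  obtain ⟨c, hc0, hctop, hc⟩ := exists_volume_image_affine L x₀
  set U : ℝ × ℝ → ℝ := fun y => (u (x₀ + ρ • l y) - u x₀) / ρ with hU
  set Q : ℝ × ℝ → ℝ := fun y => ‖l y‖ ^ 2 + ((f (x₀ + ρ • l y) - f x₀) / ρ) ^ 2 with hQ
  have hρl : ∀ y, ‖ρ • l y‖ = ρ * ‖l y‖ := fun y => by rw [norm_smul, Real.norm_of_nonneg hρ.le]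
  have hCle : C' * ρ ^ 2 ≤ (C' + K) * ρ ^ 2 :=
    mul_le_mul_of_nonneg_right (by linarith) (sq_nonneg ρ)
  set S : Set (ℝ × ℝ) := {y | ‖y‖ ≤ 2 ∧ Q y ≤ 1 ∧ ρ * P.shift + C₁ * ρ ^ 2 ≤ U y} with hS
  have hSmeas : MeasurableSet S := by
    have hlc : Continuous l := l.continuous_of_finiteDimensional
    have hmaps : Set.MapsTo (fun y => x₀ + ρ • l y) (Metric.closedBall 0 2) Ω := by
      intro y hy
      refine interior_subset (hball ?_)
      rw [Metric.mem_ball, dist_eq_norm, add_sub_cancel_left, hρl]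
      have := mul_le_mul_of_nonneg_left (hb y (by simpa using hy)).1 hρ.le
      linarith
    have hcf : ContinuousOn (fun y => f (x₀ + ρ • l y)) (Metric.closedBall 0 2) :=
      hf.continuousOn.comp (by fun_prop) hmaps
    have hcu : ContinuousOn (fun y => u (x₀ + ρ • l y)) (Metric.closedBall 0 2) :=
      hu.continuousOn.comp (by fun_prop) hmaps
    have hcU : ContinuousOn U (Metric.closedBall 0 2) :=
      (hcu.sub continuousOn_const).div_const ρ
    have hcQ : ContinuousOn Q (Metric.closedBall 0 2) :=
      (hlc.norm.pow 2).continuousOn.add (((hcf.sub continuousOn_const).div_const ρ).pow 2)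
    have h1 := (hcQ.preimage_isClosed_of_isClosed Metric.isClosed_closedBall
      (isClosed_Iic (a := (1 : ℝ)))).measurableSet
    have h2 := (hcU.preimage_isClosed_of_isClosed Metric.isClosed_closedBall
      (isClosed_Ici (a := ρ * P.shift + C₁ * ρ ^ 2))).measurableSet
    convert h1.inter h2 using 1
    ext y
    simp only [hS, Set.mem_ofPred_eq, Set.mem_inter_iff, Set.mem_preimage, Set.mem_Iic,
      Set.mem_Ici, mem_closedBall_zero_iff]
    tauto
  obtain ⟨T, hT, hvol⟩ := hcore ρ hρ hρε U Q (fun y hy => (hb y hy).2.1.trans hCle)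
    (fun y hy => (hb y hy).2.2.trans hCle) S hSmeas (fun y hy => hy)
  have hXQ : ∀ y, ‖ρ • l y‖ ^ 2 + (f (x₀ + ρ • l y) - f x₀) ^ 2 = ρ ^ 2 * Q y := by
    intro y
    simp only [hρl, hQ]
    field_simp
  have hUm : ∀ y, u (x₀ + ρ • l y) = u x₀ + ρ * U y := fun y => by
    simp only [hU]; field_simp; ring
  have hm' : m = u x₀ + ρ * (ρ * P.shift + C₁ * ρ ^ 2) := by rw [hm, hshift]; ring
  have hsub1 : {x | x ∈ amoeba nuL2 Ω f ρ x₀ ∧ m ≤ u x} ⊆ (fun y => x₀ + L y) '' S := by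
    rintro x ⟨hx, hxm⟩
    obtain ⟨y, hy⟩ := L.surjective (x - x₀)
    have hxy : x = x₀ + ρ • l y := by rw [← hLy, hy]; abel
    refine ⟨y, ?_, by rw [hxy, ← hLy]⟩
    have h1 : ‖x - x₀‖ ^ 2 + (f x - f x₀) ^ 2 ≤ ρ ^ 2 :=
      amoeba_nuL2_subset hρ.le (hf.of_le (by simp)) hx
    rw [hxy, add_sub_cancel_left, hXQ] at h1
    have hQ1 : Q y ≤ 1 := le_of_mul_le_mul_left (by linarith) (show 0 < ρ ^ 2 by positivity)
    refine ⟨hbox y hQ1, hQ1, ?_⟩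
    rw [hxy, hUm, hm'] at hxm
    exact le_of_mul_le_mul_left (by linarith) hρ
  -- The centre is removed because a segment of length zero is not a regular curve; it is a null
  -- set.
  have hsub2 : (fun y => x₀ + L y) '' T \ {x₀} ⊆
      {x | x ∈ amoeba nuL2 Ω f ρ x₀ ∧ u x < m} := by
    rintro _ ⟨⟨y, hy, rfl⟩, hne⟩
    obtain ⟨hy2, hQ1, hUy⟩ := hT y hy
    simp only [hLy, Set.mem_singleton_iff, add_eq_left] at hne ⊢
    refine ⟨hmem ρ hρ _ hne ?_ ?_, ?_⟩
    · rw [hρl]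
      have := mul_le_mul_of_nonneg_left (hb y hy2).1 hρ.le
      linarith
    · rw [hXQ, hρl]
      have h1 : ‖l y‖ ^ 2 ≤ 1 := by
        have h2 : 0 ≤ (C' + K) * ρ ^ 2 := by positivity
        have h3 : ‖l y‖ ^ 2 + ((f (x₀ + ρ • l y) - f x₀) / ρ) ^ 2 ≤ 1 - (C' + K) * ρ ^ 2 := hQ1
        linarith [sq_nonneg ((f (x₀ + ρ • l y) - f x₀) / ρ)]
      have h2 : K * (ρ * ‖l y‖) ^ 4 ≤ (C' + K) * ρ ^ 4 := by
        have h4 : (‖l y‖ ^ 2) ^ 2 ≤ 1 := pow_le_one₀ (by positivity) h1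
        calc K * (ρ * ‖l y‖) ^ 4 = K * ρ ^ 4 * (‖l y‖ ^ 2) ^ 2 := by ring
          _ ≤ K * ρ ^ 4 := mul_le_of_le_one_right (by positivity) h4
          _ ≤ (C' + K) * ρ ^ 4 := mul_le_mul_of_nonneg_right (by linarith) (by positivity)
      have h3 := mul_le_mul_of_nonneg_left hQ1 (sq_nonneg ρ)
      linarith
    · rw [hUm, hm']
      have := mul_lt_mul_of_pos_left hUy hρ
      linarith
  have hv1 : volume {x | x ∈ amoeba nuL2 Ω f ρ x₀ ∧ m ≤ u x} ≤ c * volume S :=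
    (measure_mono hsub1).trans_eq (hc S)
  have hv2 : c * volume T ≤ volume {x | x ∈ amoeba nuL2 Ω f ρ x₀ ∧ u x < m} := by
    rw [← hc T, ← measure_sdiff_null (measure_singleton x₀)]
    exact measure_mono hsub2
  -- If `S` is null, a factor larger than one gives no strict inequality; this is the second
  -- alternative.
  rcases eq_or_ne (volume S) 0 with h0 | h0
  · right
    rw [h0, mul_zero] at hv1
    exact le_antisymm hv1 bot_le
  · left
    have hSfin : volume S ≠ ⊤ := by
      refine ne_top_of_le_ne_top ?_ (measure_mono
        (show S ⊆ Metric.closedBall 0 2 from fun y hy => by simpa using hy.1))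
      exact measure_closedBall_lt_top.ne
    refine hv1.trans_lt (lt_of_lt_of_le ?_ hv2)
    refine ENNReal.mul_lt_mul_right hc0 hctop (lt_of_lt_of_le ?_ hvol)
    nth_rw 1 [← one_mul (volume S)]
    refine ENNReal.mul_lt_mul_left h0 hSfin ?_
    rw [ENNReal.one_lt_ofReal]
    have : 0 < κ * ρ ^ 2 := by positivity
    linarith

/-! ### The symmetric bound, uniqueness and the expansion -/

theorem gradient_fun_neg (u : Plane → ℝ) (x : Plane) :
    gradient (fun x => -u x) x = -gradient u x := by
  simp [gradient, fderiv_fun_neg]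

/-- Negating `u` turns its gradient by `π`, which changes the signs of `sin α` and `cos α`; each
term of the right-hand side is odd under this change. It converts upper bounds for medians of `-u`
into lower bounds for those of `u`. -/
theorem l2Rhs_neg (f u : Plane → ℝ) (φ α : ℝ) (x : Plane) :
    l2Rhs f (fun x => -u x) φ (α + Real.pi) x = -l2Rhs f u φ α x := by
  have h1 : unitNormal (φ + (α + Real.pi)) = -unitNormal (φ + α) := by
    rw [← add_assoc]
    ext i
    fin_cases i <;> simp [unitNormal]
  have h2 : ∀ v w, secondDeriv (fun x => -u x) x v w = -secondDeriv u x v w := by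
    intro v w
    have : fderiv ℝ (fun x => -u x) = fun x => -fderiv ℝ u x := by
      ext1 x
      exact fderiv_fun_neg
    unfold secondDeriv
    rw [this, fderiv_fun_neg]
    rfl
  have h3 : secondDeriv u x (-unitNormal (φ + α)) (-unitNormal (φ + α))
      = secondDeriv u x (unitNormal (φ + α)) (unitNormal (φ + α)) := by
    simp [secondDeriv]
  simp only [l2Rhs, h1, h2, h3, gradient_fun_neg, norm_neg, Real.sin_add_pi, Real.cos_add_pi]
  ring

/-- The amoeba contains a punctured disc of comparable radius. -/
theorem exists_ball_subset_amoeba {Ω : Set Plane} {f : Plane → ℝ} {x₀ : Plane}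
    (hx₀ : x₀ ∈ interior Ω) (hf : ContDiffOn ℝ ∞ f Ω) :
    ∃ β r : ℝ, 0 < β ∧ β ≤ 1 ∧ 0 < r ∧ ∀ ρ : ℝ, 0 < ρ → ρ < r →
      Metric.ball x₀ (β * ρ) \ {x₀} ⊆ amoeba nuL2 Ω f ρ x₀ := by
  have hfa : ContDiffAt ℝ 1 f x₀ :=
    (hf.contDiffAt (mem_interior_iff_mem_nhds.1 hx₀)).of_le (by simp)
  obtain ⟨G, t, ht, hG⟩ := hfa.exists_lipschitzOnWith
  obtain ⟨r', hr', hball⟩ := Metric.mem_nhds_iff.1 ht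
  obtain ⟨K, r, hK, hr, hmem⟩ := exists_mem_amoeba_of_chord_le hx₀ hf
  have hβ : 0 < 1 / (1 + (G : ℝ) + K) := by positivity
  have hβ1 : 1 / (1 + (G : ℝ) + K) ≤ 1 := by
    rw [div_le_one (by positivity)]
    linarith [G.2]
  refine ⟨1 / (1 + (G : ℝ) + K), min 1 (min r r'), hβ, hβ1, by positivity, ?_⟩
  rintro ρ hρ hρr x ⟨hx, hne⟩
  simp only [lt_min_iff] at hρr
  obtain ⟨hρ1, hρr, hρr'⟩ := hρr
  set β := 1 / (1 + (G : ℝ) + K) with hβd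
  rw [Metric.mem_ball, dist_eq_norm] at hx
  have hβρ : β * ρ ≤ ρ := mul_le_of_le_one_left hρ.le hβ1
  have hlip : (f x - f x₀) ^ 2 ≤ (G * ‖x - x₀‖) ^ 2 := by
    rw [← sq_abs, ← Real.norm_eq_abs]
    refine pow_le_pow_left₀ (norm_nonneg _) (hG.norm_sub_le (hball ?_) (hball ?_)) 2
    · rw [Metric.mem_ball, dist_eq_norm]
      linarith
    · exact Metric.mem_ball_self hr'
  have h := hmem ρ hρ (x - x₀) (sub_ne_zero.2 hne) (by linarith) ?_
  · rwa [add_sub_cancel] at h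
  · rw [add_sub_cancel]
    set n := ‖x - x₀‖
    have hn0 : 0 ≤ n := norm_nonneg _
    have hn2 : n ^ 2 ≤ β ^ 2 * ρ ^ 2 := by
      rw [← mul_pow]; exact pow_le_pow_left₀ hn0 hx.le 2
    have hn4 : K * n ^ 4 ≤ K * n ^ 2 :=
      mul_le_mul_of_nonneg_left (pow_le_pow_of_le_one hn0 (by linarith) (by norm_num)) hK
    have hGK : (1 + (G : ℝ) ^ 2 + K) * β ^ 2 ≤ 1 := by
      have h1 : (1 + (G : ℝ) + K) * β = 1 := by rw [hβd]; field_simp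
      have h2 : (1 + (G : ℝ) ^ 2 + K) ≤ (1 + (G : ℝ) + K) ^ 2 := by
        nlinarith [G.2, mul_nonneg G.2 hK, sq_nonneg K]
      calc (1 + (G : ℝ) ^ 2 + K) * β ^ 2 ≤ (1 + (G : ℝ) + K) ^ 2 * β ^ 2 := by gcongr
        _ = 1 := by rw [← mul_pow, h1, one_pow]
    calc n ^ 2 + (f x - f x₀) ^ 2 + K * n ^ 4 ≤ (1 + (G : ℝ) ^ 2 + K) * n ^ 2 := by
          linarith
      _ ≤ (1 + (G : ℝ) ^ 2 + K) * (β ^ 2 * ρ ^ 2) := by gcongr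
      _ = ((1 + (G : ℝ) ^ 2 + K) * β ^ 2) * ρ ^ 2 := by ring
      _ ≤ ρ ^ 2 := mul_le_of_le_one_left (sq_nonneg ρ) hGK

/-- Close to a regular point, a function attains on a small disc all values that differ from the
central one by a fixed multiple of the radius. -/
theorem exists_value_mem_ball {Ω : Set Plane} {u : Plane → ℝ} {x₀ : Plane}
    (hx₀ : x₀ ∈ interior Ω) (hu : ContDiffOn ℝ ∞ u Ω) (hu0 : gradient u x₀ ≠ 0) :
    ∃ c r : ℝ, 0 < c ∧ 0 < r ∧ ∀ ρ : ℝ, 0 < ρ → ρ < r → ∀ τ, |τ - u x₀| ≤ c * ρ →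
      ∃ x ∈ Metric.ball x₀ ρ, u x = τ := by
  have hua : ContDiffAt ℝ 1 u x₀ :=
    (hu.contDiffAt (mem_interior_iff_mem_nhds.1 hx₀)).of_le (by simp)
  set g := ‖gradient u x₀‖ with hg
  have hgpos : 0 < g := norm_pos_iff.2 hu0
  -- With error at most half of the linear term, `u` moves by at least `gρ/4` at distance `ρ/2` in
  -- either direction along the gradient; the intermediate value theorem does the rest.
  have hlo := (hua.differentiableAt one_ne_zero).hasFDerivAt.isLittleO.def (half_pos hgpos)
  obtain ⟨r, hr, hball⟩ := Metric.eventually_nhds_iff_ball.1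
    (hlo.and (mem_interior_iff_mem_nhds.1 hx₀))
  refine ⟨g / 4, r, by positivity, hr, ?_⟩
  intro ρ hρ hρr τ hτ
  set η := g⁻¹ • gradient u x₀ with hη
  have hη1 : ‖η‖ = 1 := by
    rw [hη, norm_smul, norm_inv, Real.norm_of_nonneg hgpos.le, ← hg, inv_mul_cancel₀ hgpos.ne']
  have haη : fderiv ℝ u x₀ η = g := by
    rw [fderiv_apply_eq_inner_gradient, hη, inner_smul_right, real_inner_self_eq_norm_sq, ← hg]
    field_simp
  have hnorm : ∀ t ∈ Set.Icc (-(ρ / 2)) (ρ / 2), x₀ + t • η ∈ Metric.ball x₀ ρ := by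
    intro t ht
    rw [Metric.mem_ball, dist_eq_norm, add_sub_cancel_left, norm_smul, hη1, mul_one,
      Real.norm_eq_abs]
    have := abs_le.2 ht
    linarith
  have hsub : Metric.ball x₀ ρ ⊆ Metric.ball x₀ r := Metric.ball_subset_ball hρr.le
  have hval : ∀ t ∈ Set.Icc (-(ρ / 2)) (ρ / 2), |u (x₀ + t • η) - u x₀ - t * g| ≤ g / 2 * |t| := by
    intro t ht
    have := (hball _ (hsub (hnorm t ht))).1
    rw [add_sub_cancel_left, norm_smul, hη1, mul_one, map_smul, haη] at this
    exact this
  have hcont : ContinuousOn (fun t : ℝ => u (x₀ + t • η)) (Set.Icc (-(ρ / 2)) (ρ / 2)) :=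
    hu.continuousOn.comp (by fun_prop) fun t ht => (hball _ (hsub (hnorm t ht))).2
  have hle : -(ρ / 2) ≤ ρ / 2 := by linarith
  have h1 := (abs_le.1 (hval _ (Set.left_mem_Icc.2 hle))).2
  have h2 := (abs_le.1 (hval _ (Set.right_mem_Icc.2 hle))).1
  rw [abs_neg, abs_of_pos (half_pos hρ)] at h1
  rw [abs_of_pos (half_pos hρ)] at h2
  have h3 := abs_le.1 hτ
  obtain ⟨t, ht, hut⟩ := intermediate_value_Icc hle hcont
    (show τ ∈ Set.Icc _ _ from ⟨by linarith [h3.1], by linarith [h3.2]⟩)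
  exact ⟨_, hnorm t ht, hut⟩

theorem exists_median_expansion {Ω : Set Plane} {f u : Plane → ℝ} {x₀ : Plane} {φ α : ℝ}
    (hf : ContDiffOn ℝ ∞ f Ω) (hu : ContDiffOn ℝ ∞ u Ω) (hx₀ : x₀ ∈ interior Ω)
    (hfφ : gradient f x₀ = ‖gradient f x₀‖ • unitVec φ) (hu0 : gradient u x₀ ≠ 0)
    (huφ : gradient u x₀ = ‖gradient u x₀‖ • unitVec (φ + α)) :
    ∃ C ρ₀ : ℝ, 0 < ρ₀ ∧ ∀ ρ : ℝ, 0 < ρ → ρ < ρ₀ →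
      (∃! μ : ℝ, IsMedian u (amoeba nuL2 Ω f ρ x₀) μ) ∧
      ∀ μ : ℝ, IsMedian u (amoeba nuL2 Ω f ρ x₀) μ →
        |μ - (u x₀ + ρ ^ 2 / 6 * l2Rhs f u φ α x₀)| ≤ C * ρ ^ 3 := by
  obtain ⟨C₁, r₁, hr₁, h₁⟩ := exists_volume_superlevel_lt hf hu hx₀ hfφ hu0 huφ
  have huφ' : gradient (fun x => -u x) x₀
      = ‖gradient (fun x => -u x) x₀‖ • unitVec (φ + (α + Real.pi)) := by
    have h1 : unitVec (φ + (α + Real.pi)) = -unitVec (φ + α) := by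
      rw [← add_assoc]
      ext i
      fin_cases i <;> simp [unitVec]
    rw [gradient_fun_neg, norm_neg, h1, smul_neg, ← huφ]
  obtain ⟨C₂, r₂, hr₂, h₂⟩ := exists_volume_superlevel_lt (u := fun x => -u x) hf hu.neg hx₀ hfφ
    (by rwa [gradient_fun_neg, neg_ne_zero]) huφ'
  obtain ⟨β, rβ, hβ, hβ1, hrβ, hball⟩ := exists_ball_subset_amoeba hx₀ hf
  obtain ⟨c, rc, hc, hrc, hvalue⟩ := exists_value_mem_ball hx₀ hu hu0
  obtain ⟨r', hr', hint⟩ := Metric.isOpen_iff.1 isOpen_interior x₀ hx₀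
  set R := l2Rhs f u φ α x₀ with hR
  set C := max C₁ C₂ with hC
  have hD : 0 < |R| / 6 + |C| + 1 := by positivity
  -- The last bound makes `(|R|/6 + |C|) ρ² ≤ c β ρ`, so that all medians lie in the range of values
  -- that `u` attains on the disc of radius `βρ`.
  refine ⟨C, min (min (min r₁ r₂) (min rβ rc)) (min (min 1 (r' / 2))
    (c * β / (|R| / 6 + |C| + 1))), by positivity, ?_⟩
  intro ρ hρ hρlt
  simp only [lt_min_iff] at hρlt
  obtain ⟨⟨⟨hρ₁, hρ₂⟩, hρβ, hρc⟩, ⟨hρ1, hρr'⟩, hρD⟩ := hρlt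
  rw [lt_div_iff₀ hD] at hρD
  set A := amoeba nuL2 Ω f ρ x₀ with hA
  set B := Metric.closedBall x₀ ρ with hB
  have hBcl : IsClosed B := Metric.isClosed_closedBall
  have hBint : B ⊆ interior Ω := fun x hx => hint (by
    rw [hB, Metric.mem_closedBall] at hx
    rw [Metric.mem_ball]
    linarith)
  have huB : ContinuousOn u B := hu.continuousOn.mono (hBint.trans interior_subset)
  have hAB : A ⊆ B := by
    intro x hx
    have h1 : ‖x - x₀‖ ^ 2 + (f x - f x₀) ^ 2 ≤ ρ ^ 2 :=
      amoeba_nuL2_subset hρ.le (hf.of_le (by simp)) hx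
    rw [hB, Metric.mem_closedBall, dist_eq_norm]
    exact (abs_le_of_sq_le_sq' (by linarith [sq_nonneg (f x - f x₀)]) hρ.le).2
  have hAfin : volume A ≠ ⊤ :=
    ne_top_of_le_ne_top measure_closedBall_lt_top.ne (measure_mono hAB)
  have hAball := hball ρ hρ hρβ
  have hβρ : 0 < β * ρ := by positivity
  have hA0 : volume A ≠ 0 := by
    have h1 : 0 < volume (Metric.ball x₀ (β * ρ) \ {x₀}) := by
      rw [measure_sdiff_null (measure_singleton x₀)]
      exact Metric.measure_ball_pos volume x₀ hβρ
    exact (h1.trans_le (measure_mono hAball)).ne'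
  have hupper : ∀ μ, IsMedian u A μ → μ < u x₀ + ρ ^ 2 / 6 * R + C₁ * ρ ^ 3 := by
    intro μ hμ
    exact hμ.lt_of_volume_lt hBcl huB hAB hAfin hA0 (h₁ ρ hρ hρ₁ _ rfl)
  have hlower : ∀ μ, IsMedian u A μ → -μ < -u x₀ + ρ ^ 2 / 6 * -R + C₂ * ρ ^ 3 := by
    intro μ hμ
    have h := h₂ ρ hρ hρ₂ _ rfl
    rw [l2Rhs_neg] at h
    exact hμ.neg.lt_of_volume_lt hBcl huB.neg hAB hAfin hA0 h
  have hexp : ∀ μ, IsMedian u A μ → |μ - (u x₀ + ρ ^ 2 / 6 * R)| ≤ C * ρ ^ 3 := by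
    intro μ hμ
    have h1 := hupper μ hμ
    have h2 := hlower μ hμ
    have h3 : C₁ * ρ ^ 3 ≤ C * ρ ^ 3 := by gcongr; exact le_max_left _ _
    have h4 : C₂ * ρ ^ 3 ≤ C * ρ ^ 3 := by gcongr; exact le_max_right _ _
    rw [abs_le]
    constructor <;> linarith
  have hclose : ∀ μ, IsMedian u A μ → |μ - u x₀| ≤ c * (β * ρ) := by
    intro μ hμ
    have h1 := hexp μ hμ
    have h2 : |μ - u x₀| ≤ |μ - (u x₀ + ρ ^ 2 / 6 * R)| + |ρ ^ 2 / 6 * R| := by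
      refine le_trans (le_of_eq ?_) (abs_add_le _ _)
      congr 1
      ring
    rw [abs_mul, abs_of_pos (show 0 < ρ ^ 2 / 6 by positivity)] at h2
    have h3 : C * ρ ^ 3 ≤ |C| * ρ ^ 2 := by
      have : ρ ^ 3 ≤ ρ ^ 2 := pow_le_pow_of_le_one hρ.le hρ1.le (by norm_num)
      exact mul_le_mul (le_abs_self C) this (by positivity) (abs_nonneg C)
    have h4 := mul_lt_mul_of_pos_left hρD hρ
    have h5 : 0 ≤ ρ ^ 2 := sq_nonneg ρ
    linarith
  -- The midpoint of two distinct medians is attained in the disc, so by continuity the values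
  -- strictly between them occupy an open set of positive area, which stays in the amoeba after the
  -- centre is removed.
  have hunique : ∀ μ₁ μ₂, IsMedian u A μ₁ → IsMedian u A μ₂ → μ₂ ≤ μ₁ := by
    intro μ₁ μ₂ h1 h2
    refine h1.le_of_volume_pos hBcl huB hAB hAfin h2 fun hlt => ?_
    have c1 := abs_le.1 (hclose μ₁ h1)
    have c2 := abs_le.1 (hclose μ₂ h2)
    have hβρc : β * ρ < rc := (mul_le_of_le_one_left hρ.le hβ1).trans_lt hρc
    obtain ⟨x, hx, hux⟩ := hvalue (β * ρ) hβρ hβρc ((μ₁ + μ₂) / 2)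
      (abs_le.2 ⟨by linarith [c1.1, c2.1], by linarith [c1.2, c2.2]⟩)
    have hballB : Metric.ball x₀ (β * ρ) ⊆ B :=
      (Metric.ball_subset_ball (mul_le_of_le_one_left hρ.le hβ1)).trans
        Metric.ball_subset_closedBall
    have hopen : IsOpen (Metric.ball x₀ (β * ρ) ∩ u ⁻¹' Set.Ioo μ₁ μ₂) :=
      (huB.mono hballB).isOpen_inter_preimage Metric.isOpen_ball isOpen_Ioo
    have hpos : 0 < volume ((Metric.ball x₀ (β * ρ) ∩ u ⁻¹' Set.Ioo μ₁ μ₂) \ {x₀}) := by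
      rw [measure_sdiff_null (measure_singleton x₀)]
      refine hopen.measure_pos volume ⟨x, hx, ?_⟩
      rw [Set.mem_preimage, hux]
      exact ⟨by linarith, by linarith⟩
    refine (hpos.trans_le (measure_mono ?_)).ne'
    rintro y ⟨⟨hy1, hy2⟩, hy3⟩
    exact ⟨hAball ⟨hy1, hy3⟩, hy2⟩
  obtain ⟨μ, hμ⟩ := exists_isMedian hBcl huB hAB hAfin
  exact ⟨⟨μ, hμ, fun μ' hμ' => le_antisymm (hunique μ μ' hμ hμ') (hunique μ' μ hμ' hμ)⟩, hexp⟩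

end Amoeba

theorem corollary1 :
    -- closed form of the three coefficient integrals for the L² amoeba metric
    (∀ s α : ℝ,
      Amoeba.J1 Amoeba.nuL2 s α =
          2 / 3 * s * (Real.cos α ^ 3 /
            ((1 + s ^ 2) * (1 + s ^ 2 * Real.sin α ^ 2) ^ (3 / 2 : ℝ))) ∧
      Amoeba.J2 Amoeba.nuL2 s α =
          2 / 3 * s * (Real.sin α ^ 3 / (1 + s ^ 2 * Real.sin α ^ 2) ^ (3 / 2 : ℝ)) ∧
      Amoeba.J3 Amoeba.nuL2 s α =
          2 / 3 * s * (Real.cos α * (2 + Real.sin α ^ 2 + 3 * s ^ 2 * Real.sin α ^ 2) /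
            ((1 + s ^ 2) ^ 2 * (1 + s ^ 2 * Real.sin α ^ 2) ^ (3 / 2 : ℝ)))) ∧
    -- the general equation becomes the explicit equation
    (∀ (f u : Amoeba.Plane → ℝ) (φ α : ℝ) (x : Amoeba.Plane),
      Amoeba.generalRhs Amoeba.nuL2 f u φ α x = Amoeba.l2Rhs f u φ α x) ∧
    -- one step of amoeba median filtering is an explicit time step of size `ρ ^ 2 / 6`
    (∀ (Ω : Set Amoeba.Plane) (_ : IsClosed Ω) (f u : Amoeba.Plane → ℝ)
      (_ : ContDiffOn ℝ ∞ f Ω) (_ : ContDiffOn ℝ ∞ u Ω)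
      (x₀ : Amoeba.Plane) (_ : x₀ ∈ interior Ω) (φ α : ℝ)
      (_ : gradient f x₀ = ‖gradient f x₀‖ • Amoeba.unitVec φ)
      (_ : gradient u x₀ ≠ 0)
      (_ : gradient u x₀ = ‖gradient u x₀‖ • Amoeba.unitVec (φ + α)),
      ∃ C ρ₀ : ℝ, 0 < ρ₀ ∧ ∀ ρ : ℝ, 0 < ρ → ρ < ρ₀ →
        (∃! μ : ℝ, Amoeba.IsMedian u (Amoeba.amoeba Amoeba.nuL2 Ω f ρ x₀) μ) ∧
        ∀ μ : ℝ, Amoeba.IsMedian u (Amoeba.amoeba Amoeba.nuL2 Ω f ρ x₀) μ →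
          |μ - (u x₀ + ρ ^ 2 / 6 * Amoeba.l2Rhs f u φ α x₀)| ≤ C * ρ ^ 3) := by
  refine ⟨fun s α => ⟨Amoeba.J1_nuL2 s α, Amoeba.J2_nuL2 s α, Amoeba.J3_nuL2 s α⟩,
    Amoeba.generalRhs_nuL2, ?_⟩
  intro Ω _ f u hf hu x₀ hx₀ φ α hfφ hu0 huφ
  exact Amoeba.exists_median_expansion hf hu hx₀ hfφ hu0 huφ
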